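/- For each $n$, let $t^{(n)}=(t^{(n)}_1,\dots,t^{(n)}_n)$ be a cycle type of size $n$ (nonnegative integers with $\sum_p p\,t^{(n)}_p=n$), and let $\tau_n$ be a uniform $t^{(n)}$-cyclic permutation, i.e. a uniformly random permutation of $\{1,\dots,n\}$ among those having exactly $t^{(n)}_p$ cycles of length $p$ for every $p$. Write $\check n := n-t^{(n)}_1$ for the number of non-fixed points, and let $\mathrm{hrec}(\tau)$ denote the number of high records of $\tau$, i.e. of positions $i$ such that $\tau(j)<\tau(i)$ for all $j<i$. Let $Y$ and $\Gamma_2$ be independent random variables with laws $\mathcal N(0,1)$ and $\mathrm{Gamma}(2,1)$ respectively, the latter being the law of the sum of two independent exponential variables of parameter $1$. Suppose that $\check n\to\infty$ and $\dfrac{\check n}{n/\sqrt{\log n}}\to\alpha$ as $n\to\infty$, for some $\alpha\in[0,\infty]$. Then, in distribution as $n\to\infty$, $$\frac{\mathrm{hrec}(\tau_n)-\log \check n}{t^{(n)}_1/\check n+\sqrt{\log\check n}}\;\longrightarrow\;\frac{\alpha}{\alpha+1}\,Y+\frac{1}{\alpha+1}\,\Gamma_2,$$ where for $\alpha=\infty$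 the coefficients $\frac{\alpha}{\alpha+1}$ and $\frac1{\alpha+1}$ are read as $1$ and $0$. In particular, if $\check n=\omega\!\left(n/\sqrt{\log n}\right)$, i.e. $n/\sqrt{\log n}=o(\check n)$, as $n\to\infty$, then in distribution $$\frac{\mathrm{hrec}(\tau_n)-\log n}{\sqrt{\log n}}\;\longrightarrow\;\mathcal N(0,1).$$ -/

import Mathlib

open MeasureTheory ProbabilityTheory Filter Asymptotics
open scoped Topology ENNReal

/-- The discrete measurable structure on the (finite) symmetric group. -/
instance permFinMeasurableSpace (n : ℕ) : MeasurableSpace (Equiv.Perm (Fin n)) := ⊤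

/-- The `t`-cyclic permutations of `Fin n`. A cycle type of size `n` is a partition `t` of `n`: the
number `t_p` of `p`-cycles is the multiplicity of `p` among its parts. The partition of a
permutation in Mathlib contains a part `1` for each fixed point. -/
def cyclicPerms {n : ℕ} (t : n.Partition) : Set (Equiv.Perm (Fin n)) :=
  {σ | σ.partition.parts = t.parts}

/-- The number `t_1` of fixed points of a `t`-cyclic permutation. -/
def numFixed {n : ℕ} (t : n.Partition) : ℕ := t.parts.count 1

/-- The number `n - t_1` of non-fixed points of a `t`-cyclic permutation. The subtraction does not
truncate, by `numFixed_le`. -/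
def numNonFixed {n : ℕ} (t : n.Partition) : ℕ := n - numFixed t

theorem numFixed_le {n : ℕ} (t : n.Partition) : numFixed t ≤ n := by
  have h : t.parts.card ≤ t.parts.sum := by
    have := Multiset.card_nsmul_le_sum (s := t.parts) (a := 1) (fun x hx => t.parts_pos hx)
    simpa using this
  exact (Multiset.count_le_card 1 t.parts).trans (h.trans t.parts_sum.le)

/-- The number of high records (left-to-right maxima) of a permutation. -/
def hrec {n : ℕ} (σ : Equiv.Perm (Fin n)) : ℕ :=
  (Finset.univ.filter fun i : Fin n => ∀ j : Fin n, j < i → σ j < σ i).card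

/-- The number `α / (α + 1)` for `α ∈ [0, ∞]`, equal to `1` at `α = ∞`. -/
noncomputable def gaussCoeff (α : ℝ≥0∞) : ℝ :=
  if α = ∞ then 1 else α.toReal / (α.toReal + 1)

/-- The number `1 / (α + 1)` for `α ∈ [0, ∞]`, equal to `0` at `α = ∞`. -/
noncomputable def gammaCoeff (α : ℝ≥0∞) : ℝ :=
  if α = ∞ then 0 else 1 / (α.toReal + 1)

/-! Write `m` for the number of non-fixed points and `S` for the support of the permutation.
Conjugation invariance of the class makes `S` a uniform `m`-subset and, given `S`, leaves the law
invariant under conjugation by permutations supported in `S`. The records come from two sources.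

The fixed points below all of `S` or above all of `S` are always records. Their number is the sum of
the two extreme gaps of a uniform `m`-subset, close to a sum of two independent geometric variables
of mean `r = (n - m) / m = t₁ / m` (`norm_sum_pow_gap_sub_le`). After rescaling this gives the Gamma
limit.

The other records are, up to a bounded number and with high probability, those of `σ` along the set
`M` of elements sent from the lower half `A` of `S` to its upper half `B` (`le_recOn_univ`,
`recOn_univ_le`). Conjugation by a permutation of the image of `M`, which lies in `B`, fixes `A`
pointwise, so it only shuffles the values on `M`. Hence these records have the law of the records of
a uniform permutation of `|M|` elements, with generating function `∏ (z + j) / (j + 1)`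
(`sum_pow_recOn_cross`). A second moment bound gives `|M| ≥ m / 8` with high probability, so the
logarithm of `|M|` is that of `m` up to `O(1)`, and the fluctuations are Gaussian of variance `log
m` (`norm_recordPGF_mul_exp_sub_le`).

The Gaussian approximation holds on each fibre of `S` with the same error bound. The characteristic
function of the number of records is therefore nearly the product of a gap factor and a Gaussian
factor (`norm_sum_exp_hrec_sub_le`), which yields the independence in the limit. The comparison
involves an auxiliary length `L`, which stays fixed while `n → ∞`; the remaining error `32 / L` is
made small at the end. Convergence in distribution follows from convergence of characteristic
functions, and what is left is the asymptotics of the normalisation. -/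

/-! ### Records and the generating function of a uniform permutation -/

/-- The number of records (left-to-right strict maxima) of `f` along a finite set `s`. -/
def recOn {α β : Type*} [LinearOrder α] [LinearOrder β] (f : α → β) (s : Finset α) : ℕ :=
  (s.filter fun i => ∀ j ∈ s, j < i → f j < f i).card

theorem recOn_congr {α β : Type*} [LinearOrder α] [LinearOrder β] {f g : α → β} {s : Finset α}
    (h : ∀ i ∈ s, f i = g i) : recOn f s = recOn g s := by
  unfold recOn
  congr 1
  ext i
  simp only [Finset.mem_filter, and_congr_right_iff]
  intro hi
  refine forall₂_congr fun j hj => ?_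
  rw [h i hi, h j hj]

theorem recOn_univ_eq_hrec {n : ℕ} (σ : Equiv.Perm (Fin n)) :
    recOn σ Finset.univ = hrec σ := by
  simp [recOn, hrec]

/-- Insertion of a last value: the permutation of `Fin (k + 1)` with last value `p` whose other
values are ordered like those of `e`. -/
def insertLast {k : ℕ} (p : Fin (k + 1)) (e : Equiv.Perm (Fin k)) : Equiv.Perm (Fin (k + 1)) :=
  (finSuccEquiv' (Fin.last k)).trans ((Equiv.optionCongr e).trans (finSuccEquiv' p).symm)

@[simp] theorem insertLast_last {k : ℕ} (p : Fin (k + 1)) (e : Equiv.Perm (Fin k)) :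
    insertLast p e (Fin.last k) = p := by
  simp [insertLast]

@[simp] theorem insertLast_castSucc {k : ℕ} (p : Fin (k + 1)) (e : Equiv.Perm (Fin k))
    (i : Fin k) : insertLast p e i.castSucc = p.succAbove (e i) := by
  rw [← Fin.succAbove_last_apply, insertLast, Equiv.trans_apply, Equiv.trans_apply,
    finSuccEquiv'_succAbove, Equiv.optionCongr_apply, Option.map_some, finSuccEquiv'_symm_some]

theorem insertLast_bijective (k : ℕ) :
    Function.Bijective fun x : Fin (k + 1) × Equiv.Perm (Fin k) => insertLast x.1 x.2 := by
  rw [Fintype.bijective_iff_injective_and_card]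
  refine ⟨?_, by simp [Fintype.card_perm, Nat.factorial_succ]⟩
  rintro ⟨p, e⟩ ⟨p', e'⟩ h
  have hp : p = p' := by simpa using congrArg (fun σ => σ (Fin.last k)) h
  subst hp
  have he : e = e' := by
    ext1 i
    have := congrArg (fun σ => σ i.castSucc) h
    simpa using this
  rw [he]

theorem hrec_insertLast {k : ℕ} (p : Fin (k + 1)) (e : Equiv.Perm (Fin k)) :
    hrec (insertLast p e) = hrec e + if p = Fin.last k then 1 else 0 := by
  unfold hrec
  rw [Finset.card_filter, Finset.card_filter, Fin.sum_univ_castSucc]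
  have h1 : (∀ j : Fin (k + 1), j < Fin.last k → insertLast p e j < insertLast p e (Fin.last k)) ↔
      p = Fin.last k := by
    constructor
    · intro h
      by_contra hp
      obtain ⟨i, hi⟩ : ∃ i, p.succAbove i = Fin.last k := Fin.exists_succAbove_eq (Ne.symm hp)
      have := h (e.symm i).castSucc (Fin.castSucc_lt_last _)
      rw [insertLast_castSucc, insertLast_last, Equiv.apply_symm_apply, hi] at this
      exact absurd this (not_lt.2 (Fin.le_last _))
    · rintro rfl j hj
      obtain ⟨i, rfl⟩ := Fin.exists_castSucc_eq.2 hj.ne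
      simp
  have h2 : ∀ i : Fin k, (∀ j : Fin (k + 1), j < i.castSucc →
      insertLast p e j < insertLast p e i.castSucc) ↔ ∀ j : Fin k, j < i → e j < e i := by
    intro i
    constructor
    · intro h j hj
      have := h j.castSucc (by simpa using hj)
      simpa using this
    · intro h j hj
      obtain ⟨j', rfl⟩ := Fin.exists_castSucc_eq.2 (hj.trans (Fin.castSucc_lt_last i)).ne
      have := h j' (by simpa using hj)
      simpa using this
  simp only [h1, h2]

/-- Adding a last value to a permutation of `k` elements does not disturb the earlier records. Of
the `k + 1` possible ranks for that value exactly one, the top rank, creates a record, whence the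
factor `z + k`. -/
theorem sum_pow_hrec (k : ℕ) (z : ℂ) :
    ∑ σ : Equiv.Perm (Fin k), z ^ hrec σ = ∏ j ∈ Finset.range k, (z + j) := by
  induction k with
  | zero => simp [hrec]
  | succ k ih =>
    rw [← (insertLast_bijective k).sum_comp (fun σ => z ^ hrec σ), Fintype.sum_prod_type,
      Finset.prod_range_succ, ← ih, Fin.sum_univ_castSucc, mul_add, add_comm]
    congr 1
    · rw [mul_comm, Finset.mul_sum]
      refine Finset.sum_congr rfl fun e _ => ?_
      simp [hrec_insertLast, pow_succ, mul_comm]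
    · have : ∀ (i : Fin k) (e : Equiv.Perm (Fin k)),
          hrec (insertLast i.castSucc e) = hrec e := fun i e => by
        simp [hrec_insertLast, (Fin.castSucc_lt_last i).ne]
      simp [this, mul_comm]

theorem recOn_univ_of_orderIso {α β γ δ : Type*} [LinearOrder α] [LinearOrder β] [LinearOrder γ]
    [Fintype γ] [LinearOrder δ] (s : Finset α) (e : γ ≃o s) (f : α → β) (g : γ → δ)
    (h : ∀ i j, g i < g j ↔ f (e i) < f (e j)) : recOn g Finset.univ = recOn f s := by
  unfold recOn
  rw [← Finset.card_map (e.toEquiv.toEmbedding.trans (Function.Embedding.subtype _))]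
  congr 1
  ext i
  simp only [Finset.mem_map, Finset.mem_filter, Finset.mem_univ, true_and, forall_const,
    Function.Embedding.trans_apply, Equiv.coe_toEmbedding, Function.Embedding.subtype_apply]
  constructor
  · rintro ⟨a, ha, rfl⟩
    refine ⟨(e a).2, fun j hj hja => ?_⟩
    have h1 : e.symm ⟨j, hj⟩ < a := by
      rw [← e.lt_iff_lt, OrderIso.apply_symm_apply]; exact hja
    simpa using (h _ _).1 (ha _ h1)
  · rintro ⟨hi, h'⟩
    refine ⟨e.symm ⟨i, hi⟩, fun b hb => ?_, by simp⟩
    rw [h]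
    rw [← e.lt_iff_lt, OrderIso.apply_symm_apply] at hb
    simpa using h' _ (e b).2 hb

/-! ### Records along the elements sent from `A` to `B` -/

/-- The elements of `A` that `σ` sends into `B`. -/
def cross {α : Type*} [DecidableEq α] (A B : Finset α) (σ : Equiv.Perm α) : Finset α :=
  A.filter fun i => σ i ∈ B

/-- Composing with every permutation of `V` makes the restriction of `σ` to `M` run through all
bijections from `M` to `V`. The increasing enumerations of `M` and `V` turn these into all
permutations of `Fin M.card`. -/
theorem sum_perm_pow_recOn {α : Type*} [LinearOrder α] (M V : Finset α)
    (σ : Equiv.Perm α) (hσ : M.image σ = V) (z : ℂ) :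
    ∑ ρ : Equiv.Perm V, z ^ recOn (fun i => Equiv.Perm.ofSubtype ρ (σ i)) M =
      ∏ j ∈ Finset.range M.card, (z + j) := by
  rw [← sum_pow_hrec]
  have hV : V.card = M.card := by rw [← hσ, Finset.card_image_of_injective _ σ.injective]
  have hM : ∀ i, σ i ∈ V ↔ i ∈ M := fun i => by rw [← hσ]; simp
  let oM := M.orderIsoOfFin rfl
  let oV := V.orderIsoOfFin hV
  let e : Fin M.card ≃ V := oM.toEquiv.trans (σ.subtypeEquiv fun i => (hM i).symm)
  refine Fintype.sum_equiv (Equiv.equivCongr e.symm oV.symm.toEquiv) _ _ fun ρ => ?_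
  congr 1
  rw [← recOn_univ_eq_hrec]
  refine (recOn_univ_of_orderIso M oM _ _ fun i j => ?_).symm
  have h : ∀ i : Fin M.card, Equiv.Perm.ofSubtype ρ (σ (oM i)) = ρ (e i) := fun i =>
    Equiv.Perm.ofSubtype_apply_coe ρ (e i)
  rw [h, h]
  simp [Equiv.equivCongr]

/-- The probability generating function of the number of records of a uniform permutation of `k`
elements. -/
noncomputable def recordPGF (k : ℕ) (z : ℂ) : ℂ := ∏ j ∈ Finset.range k, (z + j) / (j + 1)

theorem prod_eq_factorial_mul_recordPGF (k : ℕ) (z : ℂ) :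
    ∏ j ∈ Finset.range k, (z + j) = k.factorial * recordPGF k z := by
  have : ((k.factorial : ℕ) : ℂ) = ∏ j ∈ Finset.range k, ((j : ℂ) + 1) := by
    rw [← Finset.prod_range_add_one_eq_factorial]; push_cast; rfl
  rw [recordPGF, this, ← Finset.prod_mul_distrib]
  refine Finset.prod_congr rfl fun j _ => ?_
  have : (j : ℂ) + 1 ≠ 0 := Nat.cast_add_one_ne_zero j
  field_simp

/-- If `C` is stable under conjugation by the permutations supported in `B`, the records of `σ ∈ C`
among the elements sent from `A` to `B` are those of a uniform permutation. -/
theorem sum_pow_recOn_cross {α : Type*} [LinearOrder α] [Fintype α] (C : Finset (Equiv.Perm α))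
    (A B : Finset α) (hAB : Disjoint A B)
    (hC : ∀ σ ∈ C, ∀ π : Equiv.Perm α, π.support ⊆ B → π * σ * π⁻¹ ∈ C) (z : ℂ) :
    ∑ σ ∈ C, z ^ recOn σ (cross A B σ) = ∑ σ ∈ C, recordPGF (cross A B σ).card z := by
  classical
  -- The sum is split by the crossing set `M` and its image `V`. As `V ⊆ B` is disjoint from `A`,
  -- conjugation by a permutation of `V` acts on `σ` restricted to `A` as composition on the left,
  -- and it preserves each fibre.
  rw [← Finset.sum_fiberwise C (fun σ => (cross A B σ, (cross A B σ).image σ)),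
    ← Finset.sum_fiberwise C (fun σ => (cross A B σ, (cross A B σ).image σ)) (fun σ =>
      recordPGF (cross A B σ).card z)]
  refine Finset.sum_congr rfl ?_
  rintro ⟨M, V⟩ -
  set C' := C.filter fun σ => (cross A B σ, (cross A B σ).image σ) = (M, V) with hC'
  have hmem : ∀ σ ∈ C', cross A B σ = M ∧ M.image σ = V := by
    intro σ hσ
    have := (Finset.mem_filter.1 hσ).2
    simp only [Prod.mk.injEq] at this
    exact ⟨this.1, this.1 ▸ this.2⟩
  by_cases hne : C'.Nonempty
  swap
  · rw [Finset.not_nonempty_iff_eq_empty.1 hne]; simp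
  have hVB : V ⊆ B := by
    obtain ⟨σ, hσ⟩ := hne
    obtain ⟨h1, h2⟩ := hmem σ hσ
    rw [← h2, ← h1]
    intro y hy
    obtain ⟨x, hx, rfl⟩ := Finset.mem_image.1 hy
    exact (Finset.mem_filter.1 hx).2
  have hcard : V.card = M.card := by
    obtain ⟨σ, hσ⟩ := hne
    rw [← (hmem σ hσ).2, Finset.card_image_of_injective _ σ.injective]
  have hout : ∀ (ρ : Equiv.Perm V) (x : α), x ∉ V → Equiv.Perm.ofSubtype ρ x = x := fun ρ x hx =>
    Equiv.Perm.ofSubtype_apply_of_not_mem ρ hx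
  have hin : ∀ (ρ : Equiv.Perm V) (x : α), x ∈ V ↔ Equiv.Perm.ofSubtype ρ x ∈ V := fun ρ x =>
    (Equiv.Perm.ofSubtype_apply_mem_iff_mem ρ x).symm
  have hA : ∀ (ρ : Equiv.Perm V) (σ : Equiv.Perm α), ∀ i ∈ A,
      (Equiv.Perm.ofSubtype ρ * σ * (Equiv.Perm.ofSubtype ρ)⁻¹) i =
        Equiv.Perm.ofSubtype ρ (σ i) := by
    intro ρ σ i hi
    have : i ∉ V := fun h => Finset.disjoint_left.1 hAB hi (hVB h)
    rw [Equiv.Perm.mul_apply, Equiv.Perm.mul_apply, Equiv.Perm.inv_eq_iff_eq.2 (hout ρ i this).symm]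
  have hcross : ∀ (ρ : Equiv.Perm V) (σ : Equiv.Perm α),
      cross A B (Equiv.Perm.ofSubtype ρ * σ * (Equiv.Perm.ofSubtype ρ)⁻¹) = cross A B σ := by
    intro ρ σ
    refine Finset.filter_congr fun i hi => ?_
    rw [hA ρ σ i hi]
    by_cases h : σ i ∈ V
    · exact iff_of_true (hVB ((hin ρ _).1 h)) (hVB h)
    · rw [hout ρ _ h]
  have hconj : ∀ (ρ : Equiv.Perm V), ∀ σ ∈ C',
      Equiv.Perm.ofSubtype ρ * σ * (Equiv.Perm.ofSubtype ρ)⁻¹ ∈ C' := by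
    intro ρ σ hσ
    refine Finset.mem_filter.2 ⟨hC σ (Finset.mem_filter.1 hσ).1 _ fun x hx => ?_, ?_⟩
    · by_contra h
      exact Equiv.Perm.mem_support.1 hx (hout ρ x fun h' => h (hVB h'))
    · rw [hcross, (hmem σ hσ).1, Prod.mk.injEq]
      refine ⟨rfl, ?_⟩
      have hsub : M ⊆ A := by rw [← (hmem σ hσ).1]; exact Finset.filter_subset _ _
      rw [Finset.image_congr (g := fun i => Equiv.Perm.ofSubtype ρ (σ i))
        fun i hi => hA ρ σ i (hsub hi)]
      refine Finset.eq_of_subset_of_card_le (fun y hy => ?_) ?_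
      · obtain ⟨x, hx, rfl⟩ := Finset.mem_image.1 hy
        refine (hin ρ _).1 ?_
        rw [← (hmem σ hσ).2]
        exact Finset.mem_image_of_mem _ hx
      · rw [hcard, Finset.card_image_of_injective]
        exact (Equiv.Perm.ofSubtype ρ).injective.comp σ.injective
  have hperm : ∀ ρ : Equiv.Perm V, ∑ σ ∈ C', z ^ recOn σ M =
      ∑ σ ∈ C', z ^ recOn (fun i => Equiv.Perm.ofSubtype ρ (σ i)) M := by
    intro ρ
    symm
    refine Finset.sum_bij' (fun σ _ => Equiv.Perm.ofSubtype ρ * σ * (Equiv.Perm.ofSubtype ρ)⁻¹)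
      (fun σ _ => Equiv.Perm.ofSubtype ρ⁻¹ * σ * (Equiv.Perm.ofSubtype ρ⁻¹)⁻¹)
      (fun σ hσ => hconj ρ σ hσ) (fun σ hσ => hconj ρ⁻¹ σ hσ) ?_ ?_ ?_
    · intro σ _; simp [mul_assoc]
    · intro σ _; simp [mul_assoc]
    · intro σ hσ
      have hsub : M ⊆ A := by rw [← (hmem σ hσ).1]; exact Finset.filter_subset _ _
      rw [recOn_congr fun i hi => hA ρ σ i (hsub hi)]
  -- The fibre sum is unchanged by each of the `M.card.factorial` conjugations, so it may be
  -- replaced by its average over them.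
  have key : (M.card.factorial : ℂ) * ∑ σ ∈ C', z ^ recOn σ M =
      M.card.factorial * ∑ σ ∈ C', recordPGF M.card z := by
    have h1 : ∑ ρ : Equiv.Perm V, ∑ σ ∈ C', z ^ recOn σ M =
        (M.card.factorial : ℂ) * ∑ σ ∈ C', z ^ recOn σ M := by
      simp [Fintype.card_perm, hcard]
    rw [← h1, Finset.sum_congr rfl fun ρ _ => hperm ρ, Finset.sum_comm, Finset.mul_sum]
    refine Finset.sum_congr rfl fun σ hσ => ?_
    rw [sum_perm_pow_recOn M V σ (hmem σ hσ).2, prod_eq_factorial_mul_recordPGF]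
  have := mul_left_cancel₀ (Nat.cast_ne_zero.2 (Nat.factorial_ne_zero _)) key
  rw [Finset.sum_congr rfl fun σ hσ => by rw [(hmem σ hσ).1], this]
  exact Finset.sum_congr rfl fun σ hσ => by rw [(hmem σ hσ).1]

/-! ### Moments of the number of crossings in a conjugation-stable class -/

/-- The permutations in `C` have support `S`, and `C` is stable under conjugation by the
permutations supported in `S`. -/
structure IsConjStable {α : Type*} [Fintype α] [DecidableEq α] (C : Finset (Equiv.Perm α))
    (S : Finset α) : Prop where
  conj_mem : ∀ σ ∈ C, ∀ π : Equiv.Perm α, π.support ⊆ S → π * σ * π⁻¹ ∈ C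
  support_eq : ∀ σ ∈ C, σ.support = S

namespace IsConjStable

variable {α : Type*} [Fintype α] [DecidableEq α] {C : Finset (Equiv.Perm α)} {S : Finset α}

theorem apply_ne (h : IsConjStable C S) {σ : Equiv.Perm α} (hσ : σ ∈ C) {i : α} (hi : i ∈ S) :
    σ i ≠ i := by
  rw [← h.support_eq σ hσ] at hi
  exact Equiv.Perm.mem_support.1 hi

theorem apply_mem (h : IsConjStable C S) {σ : Equiv.Perm α} (hσ : σ ∈ C) {i : α} :
    σ i ∈ S ↔ i ∈ S := by
  rw [← h.support_eq σ hσ, Equiv.Perm.apply_mem_support]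

theorem card_filter_conj (h : IsConjStable C S) (π : Equiv.Perm α) (hπ : π.support ⊆ S)
    (p : Equiv.Perm α → Prop) [DecidablePred p] :
    (C.filter fun σ => p (π * σ * π⁻¹)).card = (C.filter p).card := by
  refine Finset.card_bij' (fun σ _ => π * σ * π⁻¹) (fun σ _ => π⁻¹ * σ * π) ?_ ?_ ?_ ?_
  · intro σ hσ
    rw [Finset.mem_filter] at hσ ⊢
    exact ⟨h.conj_mem σ hσ.1 π hπ, hσ.2⟩
  · intro σ hσ
    rw [Finset.mem_filter] at hσ ⊢
    refine ⟨?_, by simpa [mul_assoc] using hσ.2⟩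
    simpa using h.conj_mem σ hσ.1 π⁻¹ (by simpa using hπ)
  · intro σ _; simp [mul_assoc]
  · intro σ _; simp [mul_assoc]

/-- Conjugation by a transposition of `j` and `k` fixes `i` and exchanges the events `σ i = j` and
`σ i = k`. Thus the image of `i` is uniform on the `S.card - 1` other points of `S`. -/
theorem card_filter_apply_eq (h : IsConjStable C S) {i j : α} (hi : i ∈ S) (hj : j ∈ S)
    (hij : i ≠ j) :
    ((S.card : ℝ) - 1) * (C.filter fun σ => σ i = j).card = C.card := by
  have h1 : ∀ k ∈ S.erase i, (C.filter fun σ => σ i = k).card = (C.filter fun σ => σ i = j).card := by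
    intro k hk
    obtain ⟨hki, hk⟩ := Finset.mem_erase.1 hk
    rw [← h.card_filter_conj (Equiv.swap j k) ?_ (fun σ => σ i = k)]
    · congr 1
      refine Finset.filter_congr fun σ _ => ?_
      rw [Equiv.Perm.mul_apply, Equiv.Perm.mul_apply, Equiv.swap_inv,
        Equiv.swap_apply_of_ne_of_ne hij hki.symm, Equiv.swap_apply_eq_iff, Equiv.swap_apply_right]
    · intro x hx
      rw [Equiv.Perm.mem_support] at hx
      by_contra hxS
      exact hx (Equiv.swap_apply_of_ne_of_ne (fun e => hxS (e ▸ hj)) (fun e => hxS (e ▸ hk)))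
  have h2 : C.card = ∑ k ∈ S.erase i, (C.filter fun σ => σ i = k).card :=
    Finset.card_eq_sum_card_fiberwise fun σ hσ =>
      Finset.mem_erase.2 ⟨h.apply_ne hσ hi, (h.apply_mem hσ).2 hi⟩
  rw [Finset.sum_congr rfl h1, Finset.sum_const, Finset.card_erase_of_mem hi, smul_eq_mul] at h2
  rw [h2, Nat.cast_mul, Nat.cast_sub (Finset.card_pos.2 ⟨i, hi⟩)]
  simp

/-- Conjugations fixing `i` and `i'` make all ordered pairs of distinct targets in `S` minus `{i,
i'}` equally likely. There are `(S.card - 2) * (S.card - 3)` of them. Only an inequality results,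
because `i` and `i'` may also be sent to each other or to themselves crosswise with a third point.
-/
theorem card_filter_apply_two_le (h : IsConjStable C S) {i i' j j' : α} (hi : i ∈ S)
    (hi' : i' ∈ S) (hj : j ∈ S) (hj' : j' ∈ S) (hii : i ≠ i') (hjj : j ≠ j') (hij : i ≠ j)
    (hij' : i ≠ j') (hi'j : i' ≠ j) (hi'j' : i' ≠ j') :
    ((S.card : ℝ) - 2) * ((S.card : ℝ) - 3) * (C.filter fun σ => σ i = j ∧ σ i' = j').card ≤
      C.card := by
  set T := (S.erase i).erase i' with hT
  have hTmem : ∀ x, x ∈ T ↔ x ≠ i' ∧ x ≠ i ∧ x ∈ S := fun x => by simp [hT]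
  have h1 : ∀ k ∈ T.offDiag, (C.filter fun σ => (σ i, σ i') = k).card =
      (C.filter fun σ => σ i = j ∧ σ i' = j').card := by
    rintro ⟨k, k'⟩ hk
    obtain ⟨hk, hk', hkk⟩ := Finset.mem_offDiag.1 hk
    simp only at hk hk' hkk
    rw [hTmem] at hk hk'
    set l := Equiv.swap j k j' with hl
    have hlk : k ≠ l := by
      intro e
      rw [hl, eq_comm, Equiv.swap_apply_eq_iff, Equiv.swap_apply_right] at e
      exact hjj e.symm
    have hl3 : l = j ∨ l = k ∨ l = j' := by
      rw [hl, Equiv.swap_apply_def]; split_ifs <;> simp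
    have hlT : l ≠ i' ∧ l ≠ i ∧ l ∈ S := by
      rcases hl3 with e | e | e <;> rw [e]
      exacts [⟨hi'j.symm, hij.symm, hj⟩, hk, ⟨hi'j'.symm, hij'.symm, hj'⟩]
    -- The first transposition sends `j` to `k` and `j'` to `l`; the second one then corrects `l` to
    -- `k'`. None of `j`, `k`, `l`, `k'` equals `i` or `i'`, so `π` fixes both.
    set π := Equiv.swap l k' * Equiv.swap j k with hπ
    have hπj : π j = k := by
      rw [hπ, Equiv.Perm.mul_apply, Equiv.swap_apply_left,
        Equiv.swap_apply_of_ne_of_ne hlk hkk]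
    have hπj' : π j' = k' := by
      rw [hπ, Equiv.Perm.mul_apply, ← hl, Equiv.swap_apply_left]
    have hfix : ∀ x, x ≠ j → x ≠ k → x ≠ l → x ≠ k' → π x = x := by
      intro x h1 h2 h3 h4
      rw [hπ, Equiv.Perm.mul_apply, Equiv.swap_apply_of_ne_of_ne h1 h2,
        Equiv.swap_apply_of_ne_of_ne h3 h4]
    have hπi : π⁻¹ i = i := by
      rw [Equiv.Perm.inv_eq_iff_eq, hfix i hij hk.2.1.symm hlT.2.1.symm hk'.2.1.symm]
    have hπi' : π⁻¹ i' = i' := by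
      rw [Equiv.Perm.inv_eq_iff_eq, hfix i' hi'j hk.1.symm hlT.1.symm hk'.1.symm]
    rw [← h.card_filter_conj π ?_ (fun σ => (σ i, σ i') = (k, k'))]
    · congr 1
      refine Finset.filter_congr fun σ _ => ?_
      have hconj : ∀ x, (π * σ * π⁻¹) x = π (σ (π⁻¹ x)) := fun _ => rfl
      rw [Prod.mk.injEq, hconj, hconj, hπi, hπi']
      conv_lhs => rw [← hπj, ← hπj']
      exact and_congr π.injective.eq_iff π.injective.eq_iff
    · intro x hx
      rw [Equiv.Perm.mem_support] at hx
      by_contra hxS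
      exact hx (hfix x (fun e => hxS (e ▸ hj)) (fun e => hxS (e ▸ hk.2.2))
        (fun e => hxS (e ▸ hlT.2.2)) (fun e => hxS (e ▸ hk'.2.2)))
  have h2 : ∑ k ∈ T.offDiag, (C.filter fun σ => (σ i, σ i') = k).card ≤ C.card := by
    rw [Finset.sum_card_fiberwise_eq_card_filter]
    exact Finset.card_filter_le _ _
  have hcT : T.card = S.card - 2 := by
    rw [hT, Finset.card_erase_of_mem (Finset.mem_erase.2 ⟨hii.symm, hi'⟩),
      Finset.card_erase_of_mem hi]
    omega
  have hS4 : 2 ≤ S.card := by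
    have : ({i, i'} : Finset α) ⊆ S := by simp [Finset.insert_subset_iff, hi, hi']
    simpa [Finset.card_pair hii] using Finset.card_le_card this
  rw [Finset.sum_congr rfl h1, Finset.sum_const, Finset.offDiag_card, hcT, smul_eq_mul] at h2
  have h3 : (((S.card - 2) * (S.card - 2) - (S.card - 2) : ℕ) : ℝ) =
      ((S.card : ℝ) - 2) * ((S.card : ℝ) - 3) := by
    rw [Nat.cast_sub (Nat.le_mul_self _), Nat.cast_mul, Nat.cast_sub hS4]
    push_cast; ring
  rw [← h3]
  exact_mod_cast h2

theorem sum_card_cross (h : IsConjStable C S) {A B : Finset α} (hA : A ⊆ S) (hB : B ⊆ S)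
    (hAB : Disjoint A B) :
    ((S.card : ℝ) - 1) * ∑ σ ∈ C, ((cross A B σ).card : ℝ) = A.card * B.card * C.card := by
  have h1 : ∀ σ : Equiv.Perm α, ((cross A B σ).card : ℝ) =
      ∑ i ∈ A, ∑ j ∈ B, if σ i = j then (1 : ℝ) else 0 := fun σ => by
    simp [cross, Finset.sum_ite_eq]
  simp only [h1]
  rw [Finset.sum_comm, Finset.mul_sum]
  have h2 : ∀ i ∈ A, ((S.card : ℝ) - 1) * ∑ σ ∈ C, ∑ j ∈ B, (if σ i = j then (1 : ℝ) else 0) =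
      B.card * C.card := by
    intro i hi
    rw [Finset.sum_comm, Finset.mul_sum]
    rw [Finset.sum_congr rfl (g := fun _ => (C.card : ℝ)), Finset.sum_const, nsmul_eq_mul]
    intro j hj
    rw [← h.card_filter_apply_eq (hA hi) (hB hj) (fun e => Finset.disjoint_left.1 hAB hi (e ▸ hj))]
    simp
  rw [Finset.sum_congr rfl h2, Finset.sum_const, nsmul_eq_mul, mul_assoc]

/-- The second factorial moment counts ordered pairs of distinct crossing elements together with
their images, so the joint bound for two prescribed images applies to each term. -/
theorem sum_card_cross_sq_le (h : IsConjStable C S) {A B : Finset α} (hA : A ⊆ S) (hB : B ⊆ S)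
    (hAB : Disjoint A B) :
    ((S.card : ℝ) - 2) * ((S.card : ℝ) - 3) *
      ∑ σ ∈ C, (((cross A B σ).card : ℝ) ^ 2 - (cross A B σ).card) ≤
      (A.card * B.card) ^ 2 * C.card := by
  set m := ((S.card : ℝ) - 2) * ((S.card : ℝ) - 3) with hm
  have h1 : ∀ σ : Equiv.Perm α, ((cross A B σ).card : ℝ) ^ 2 - (cross A B σ).card =
      ∑ x ∈ A.offDiag, ∑ y ∈ B.offDiag, if σ x.1 = y.1 ∧ σ x.2 = y.2 then (1 : ℝ) else 0 := by
    intro σ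
    have h2 : ∑ x ∈ A.offDiag, ∑ y ∈ B.offDiag,
        (if σ x.1 = y.1 ∧ σ x.2 = y.2 then (1 : ℝ) else 0) =
        ∑ x ∈ A.offDiag, if x ∈ (cross A B σ).offDiag then (1 : ℝ) else 0 := by
      refine Finset.sum_congr rfl fun x hx => ?_
      obtain ⟨hx1, hx2, hx3⟩ := Finset.mem_offDiag.1 hx
      have : ∀ y : α × α, (σ x.1 = y.1 ∧ σ x.2 = y.2) ↔ (σ x.1, σ x.2) = y := fun y => by
        rw [Prod.ext_iff]
      simp only [this, Finset.sum_ite_eq]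
      refine if_congr ?_ rfl rfl
      simp [cross, Finset.mem_offDiag, hx1, hx2, hx3, σ.injective.eq_iff]
    rw [h2, Finset.sum_ite_mem, Finset.inter_eq_right.2, Finset.sum_const, Finset.offDiag_card,
      nsmul_one, Nat.cast_sub (Nat.le_mul_self _)]
    · push_cast; ring
    · exact Finset.offDiag_mono (Finset.filter_subset _ _)
  simp only [h1]
  rw [Finset.sum_comm, Finset.mul_sum]
  have h2 : ∀ x ∈ A.offDiag, m * ∑ σ ∈ C, ∑ y ∈ B.offDiag,
      (if σ x.1 = y.1 ∧ σ x.2 = y.2 then (1 : ℝ) else 0) ≤ (B.card : ℝ) ^ 2 * C.card := by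
    intro x hx
    obtain ⟨hx1, hx2, hx3⟩ := Finset.mem_offDiag.1 hx
    rw [Finset.sum_comm, Finset.mul_sum]
    calc _ ≤ ∑ y ∈ B.offDiag, (C.card : ℝ) := by
          refine Finset.sum_le_sum fun y hy => ?_
          obtain ⟨hy1, hy2, hy3⟩ := Finset.mem_offDiag.1 hy
          have hne : ∀ {a b}, a ∈ A → b ∈ B → a ≠ b := fun ha hb e =>
            Finset.disjoint_left.1 hAB ha (e ▸ hb)
          have := h.card_filter_apply_two_le (hA hx1) (hA hx2) (hB hy1) (hB hy2) hx3 hy3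
            (hne hx1 hy1) (hne hx1 hy2) (hne hx2 hy1) (hne hx2 hy2)
          simpa using this
      _ ≤ _ := by
          rw [Finset.sum_const, nsmul_eq_mul, Finset.offDiag_card]
          gcongr
          calc (((B.card * B.card - B.card : ℕ)) : ℝ) ≤ ((B.card * B.card : ℕ) : ℝ) := by
                exact_mod_cast Nat.sub_le _ _
            _ = _ := by push_cast; ring
  calc _ ≤ ∑ x ∈ A.offDiag, (B.card : ℝ) ^ 2 * C.card := Finset.sum_le_sum h2
    _ ≤ _ := by
      rw [Finset.sum_const, nsmul_eq_mul, Finset.offDiag_card, mul_pow, mul_assoc]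
      gcongr
      calc (((A.card * A.card - A.card : ℕ)) : ℝ) ≤ ((A.card * A.card : ℕ) : ℝ) := by
            exact_mod_cast Nat.sub_le _ _
        _ = _ := by push_cast; ring

/-- Chebyshev's inequality for the number of elements sent from `A` to `B`. -/
theorem card_filter_cross_le (h : IsConjStable C S) {A B : Finset α} (hA : A ⊆ S) (hB : B ⊆ S)
    (hAB : Disjoint A B) (hS : 8 ≤ S.card) {μ : ℝ} (hμ : 0 < μ)
    (hμe : μ = A.card * B.card / ((S.card : ℝ) - 1)) :
    ((C.filter fun σ => ((cross A B σ).card : ℝ) ≤ μ / 2).card : ℝ) ≤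
      4 * (1 / μ + 6 / S.card) * C.card := by
  set m := (S.card : ℝ) with hm
  have hm8 : (8 : ℝ) ≤ m := by rw [hm]; exact_mod_cast hS
  have hm0 : 0 < m := lt_of_lt_of_le (by norm_num) hm8
  have hab : (A.card * B.card : ℝ) = μ * (m - 1) := by
    rw [hμe, div_mul_cancel₀]; linarith
  have e1 : ∑ σ ∈ C, ((cross A B σ).card : ℝ) = μ * C.card := by
    have := h.sum_card_cross hA hB hAB
    rw [hab] at this
    have h1 : m - 1 ≠ 0 := by linarith
    apply mul_left_cancel₀ h1
    rw [this]; ring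
  have e2 : ∑ σ ∈ C, (((cross A B σ).card : ℝ) ^ 2 - (cross A B σ).card) ≤
      μ ^ 2 * (1 + 6 / m) * C.card := by
    have := h.sum_card_cross_sq_le hA hB hAB
    rw [hab] at this
    -- The factor `1 + 6 / m` absorbs the quotient of `(m - 1) ^ 2` by `(m - 2) * (m - 3)`; this is
    -- where `8 ≤ m` is needed. The variance is then at most `μ + 6 * μ ^ 2 / m`.
    have hp : 0 < (m - 2) * (m - 3) := by
      apply mul_pos <;> linarith
    have h2 : (m - 1) ^ 2 ≤ (1 + 6 / m) * ((m - 2) * (m - 3)) := by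
      have : (1 + 6 / m) = (m + 6) / m := by
        rw [add_div, div_self hm0.ne']
      rw [this, div_mul_eq_mul_div, le_div_iff₀ hm0]
      nlinarith
    rw [← mul_le_mul_iff_right₀ hp]
    refine this.trans ?_
    have h3 : 0 ≤ μ ^ 2 * (C.card : ℝ) := mul_nonneg (sq_nonneg _) (Nat.cast_nonneg _)
    linarith [mul_le_mul_of_nonneg_left h2 h3]
  have e3 : ∑ σ ∈ C, (((cross A B σ).card : ℝ) - μ) ^ 2 ≤ (μ + μ ^ 2 * (6 / m)) * C.card := by
    have : ∀ σ ∈ C, (((cross A B σ).card : ℝ) - μ) ^ 2 =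
        (((cross A B σ).card : ℝ) ^ 2 - (cross A B σ).card) +
          (1 - 2 * μ) * (cross A B σ).card + μ ^ 2 := fun σ _ => by ring
    rw [Finset.sum_congr rfl this, Finset.sum_add_distrib, Finset.sum_add_distrib,
      ← Finset.mul_sum, e1, Finset.sum_const, nsmul_eq_mul]
    linarith
  have e4 : (μ / 2) ^ 2 * ((C.filter fun σ => ((cross A B σ).card : ℝ) ≤ μ / 2).card : ℝ) ≤
      ∑ σ ∈ C, (((cross A B σ).card : ℝ) - μ) ^ 2 := by
    rw [mul_comm, ← nsmul_eq_mul, ← Finset.sum_const]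
    refine (Finset.sum_le_sum fun σ hσ => ?_).trans
      (Finset.sum_le_sum_of_subset_of_nonneg (Finset.filter_subset _ _) fun _ _ _ => sq_nonneg _)
    have := (Finset.mem_filter.1 hσ).2
    nlinarith
  have hp : 0 < (μ / 2) ^ 2 := by positivity
  rw [← mul_le_mul_iff_right₀ hp]
  refine (e4.trans e3).trans (le_of_eq ?_)
  have h5 : μ ^ 2 * (1 / μ) = μ := by rw [sq, mul_assoc, mul_one_div_cancel hμ.ne', mul_one]
  linear_combination -(C.card : ℝ) * h5

theorem card_filter_apply_eq_le (h : IsConjStable C S) {i j : α} (hi : i ∈ S) (hj : j ∈ S) :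
    ((S.card : ℝ) - 1) * (C.filter fun σ => σ i = j).card ≤ C.card := by
  by_cases hij : i = j
  · rw [Finset.filter_false_of_mem fun σ hσ => hij ▸ h.apply_ne hσ hi]
    simp
  · exact (h.card_filter_apply_eq hi hj hij).le

theorem card_filter_apply_mem_le (h : IsConjStable C S) {i : α} {B : Finset α} (hi : i ∈ S)
    (hB : B ⊆ S) :
    ((S.card : ℝ) - 1) * (C.filter fun σ => σ i ∈ B).card ≤ B.card * C.card := by
  rw [← Finset.sum_card_fiberwise_eq_card_filter, Nat.cast_sum, Finset.mul_sum, ← nsmul_eq_mul]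
  exact Finset.sum_le_card_nsmul _ _ _ fun j hj => h.card_filter_apply_eq_le hi (hB hj)

theorem card_filter_inv_apply_mem_le (h : IsConjStable C S) {j : α} {A : Finset α} (hj : j ∈ S)
    (hA : A ⊆ S) :
    ((S.card : ℝ) - 1) * (C.filter fun σ => σ⁻¹ j ∈ A).card ≤ A.card * C.card := by
  rw [← Finset.sum_card_fiberwise_eq_card_filter, Nat.cast_sum, Finset.mul_sum, ← nsmul_eq_mul]
  refine Finset.sum_le_card_nsmul _ _ _ fun i hi => ?_
  refine le_trans (le_of_eq ?_) (h.card_filter_apply_eq_le (hA hi) hj)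
  congr 3
  refine Finset.filter_congr fun σ _ => ?_
  rw [Equiv.Perm.inv_eq_iff_eq, eq_comm]

end IsConjStable

/-! ### Comparison of all records with the crossing records -/

theorem exists_lower_subset {α : Type*} [LinearOrder α] (S : Finset α) {k : ℕ} (hk : k ≤ S.card) :
    ∃ T ⊆ S, T.card = k ∧ ∀ x ∈ T, ∀ y ∈ S, y ∉ T → x < y := by
  induction k with
  | zero => exact ⟨∅, by simp, by simp, by simp⟩
  | succ k ih =>
    obtain ⟨T, hTS, hT, h⟩ := ih (by omega)
    have hne : (S \ T).Nonempty := by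
      rw [← Finset.card_pos, Finset.card_sdiff_of_subset hTS]; omega
    set a := (S \ T).min' hne with ha
    have haS : a ∈ S \ T := Finset.min'_mem _ _
    rw [Finset.mem_sdiff] at haS
    refine ⟨insert a T, Finset.insert_subset haS.1 hTS, by
      rw [Finset.card_insert_of_notMem haS.2, hT], ?_⟩
    intro x hx y hy hyT
    rw [Finset.mem_insert, not_or] at hyT
    rcases Finset.mem_insert.1 hx with rfl | hx
    · exact lt_of_le_of_ne (Finset.min'_le _ _ (Finset.mem_sdiff.2 ⟨hy, hyT.2⟩)) (Ne.symm hyT.1)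
    · exact h x hx y hy hyT.2

/-- The number of elements below all elements of `S`. -/
def lowGap {α : Type*} [LinearOrder α] [Fintype α] (S : Finset α) : ℕ :=
  (Finset.univ.filter fun i => ∀ s ∈ S, i < s).card

/-- The number of elements above all elements of `S`. -/
def highGap {α : Type*} [LinearOrder α] [Fintype α] (S : Finset α) : ℕ :=
  (Finset.univ.filter fun i => ∀ s ∈ S, s < i).card

theorem recOn_eq_card {α β : Type*} [LinearOrder α] [LinearOrder β] (f : α → β) (s : Finset α)
    [DecidablePred fun i => ∀ j ∈ s, j < i → f j < f i] :
    recOn f s = (s.filter fun i => ∀ j ∈ s, j < i → f j < f i).card := by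
  unfold recOn
  congr!

section Sandwich

variable {α : Type*} [LinearOrder α] [Fintype α] {S A B : Finset α} {σ : Equiv.Perm α}

/-- Fixed points outside the span of `S` are records. A record along the crossing set is a record
outright: a smaller element of `S` lies in `A`, and if it does not cross then its value stays in
`A`, below `B`; a smaller fixed point keeps a value below `i`, while `σ i` lies in `B`, above `i`.
-/
theorem le_recOn_univ (hσ : σ.support = S) (hne : S.Nonempty) (hA : A ⊆ S)
    (hS : S ⊆ A ∪ B) (hAB : ∀ x ∈ A, ∀ y ∈ B, x < y) :
    lowGap S + highGap S + recOn σ (cross A B σ) ≤ recOn σ Finset.univ := by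
  have hfix : ∀ i, i ∉ S → σ i = i := fun i hi => by
    rwa [← hσ, Equiv.Perm.notMem_support] at hi
  have hmap : ∀ i, σ i ∈ S ↔ i ∈ S := fun i => by rw [← hσ, Equiv.Perm.apply_mem_support]
  obtain ⟨s, hs⟩ := hne
  have hd1 : Disjoint (Finset.univ.filter fun i => ∀ s ∈ S, i < s)
      (Finset.univ.filter fun i => ∀ s ∈ S, s < i) := by
    rw [Finset.disjoint_filter]
    exact fun i _ h h' => lt_asymm (h s hs) (h' s hs)
  have hd2 : Disjoint ((Finset.univ.filter fun i => ∀ s ∈ S, i < s) ∪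
      (Finset.univ.filter fun i => ∀ s ∈ S, s < i))
      ((cross A B σ).filter fun i => ∀ j ∈ cross A B σ, j < i → σ j < σ i) := by
    rw [Finset.disjoint_left]
    intro i hi hi'
    have hiS : i ∈ S := hA (Finset.mem_filter.1 (Finset.mem_filter.1 hi').1).1
    rcases Finset.mem_union.1 hi with h | h
    · exact lt_irrefl _ ((Finset.mem_filter.1 h).2 i hiS)
    · exact lt_irrefl _ ((Finset.mem_filter.1 h).2 i hiS)
  have hrecM := recOn_eq_card σ (cross A B σ)
  have hrecU := recOn_eq_card σ Finset.univ
  rw [hrecM, hrecU, lowGap, highGap, ← Finset.card_union_of_disjoint hd1,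
    ← Finset.card_union_of_disjoint hd2]
  refine Finset.card_le_card fun i hi => Finset.mem_filter.2 ⟨Finset.mem_univ _, ?_⟩
  intro j _ hji
  rcases Finset.mem_union.1 hi with hi | hi
  · have hiS : i ∉ S := fun h => by
      rcases Finset.mem_union.1 hi with h' | h' <;>
        exact lt_irrefl _ ((Finset.mem_filter.1 h').2 i h)
    rw [hfix i hiS]
    rcases Finset.mem_union.1 hi with h' | h'
    · have h' := (Finset.mem_filter.1 h').2
      rwa [hfix j fun hj => lt_asymm hji (h' j hj)]
    · have h' := (Finset.mem_filter.1 h').2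
      by_cases hj : j ∈ S
      · exact h' _ ((hmap j).2 hj)
      · rwa [hfix j hj]
  · obtain ⟨hiM, hrec⟩ := Finset.mem_filter.1 hi
    obtain ⟨hiA, hiB⟩ := Finset.mem_filter.1 hiM
    by_cases hj : j ∈ S
    · have hjA : j ∈ A := by
        rcases Finset.mem_union.1 (hS hj) with h | h
        · exact h
        · exact absurd (hAB i hiA j h) (not_lt.2 hji.le)
      by_cases hjB : σ j ∈ B
      · exact hrec j (Finset.mem_filter.2 ⟨hjA, hjB⟩) hji
      · rcases Finset.mem_union.1 (hS ((hmap j).2 hj)) with h | h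
        · exact hAB _ h _ hiB
        · exact absurd h hjB
    · rw [hfix j hj]
      exact hji.trans (hAB i hiA _ hiB)

/-- Here `AL` and `BL` are the bottom and top segments of `S`. An early element `a` of `AL` already
takes a value in `B`, so an element of `A` with value in `A` can be a record only inside `AL`. Some
`b` in `A` takes a value in `BL`, so an element of `B` can be a record only if its value lies in
`BL`. These two kinds account for at most `AL.card + BL.card` records. -/
theorem recOn_univ_le {AL BL : Finset α} {p q : α} (hσ : σ.support = S) (hS : S ⊆ A ∪ B)
    (hA : A ⊆ S)
    (hAB : ∀ x ∈ A, ∀ y ∈ B, x < y) (hALA : AL ⊆ A)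
    (hAL : ∀ x ∈ AL, ∀ y ∈ S, y ∉ AL → x < y) (hBL : ∀ y ∈ BL, ∀ x ∈ S, x ∉ BL → x < y)
    (hp : p ∈ S) (hpmin : ∀ s ∈ S, p ≤ s) (hq : q ∈ S) (hqmax : ∀ s ∈ S, s ≤ q)
    (h1 : (cross AL B σ).Nonempty) (h2 : (cross A BL σ).Nonempty) (h3 : σ p ∉ AL)
    (h4 : σ⁻¹ q ∉ BL) :
    recOn σ Finset.univ ≤
      lowGap S + highGap S + recOn σ (cross A B σ) + (AL.card + BL.card) := by
  have hmap : ∀ i, σ i ∈ S ↔ i ∈ S := fun i => by rw [← hσ, Equiv.Perm.apply_mem_support]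
  have hfix : ∀ i, i ∉ S → σ i = i := fun i hi => by
    rwa [← hσ, Equiv.Perm.notMem_support] at hi
  obtain ⟨a, ha⟩ := h1
  obtain ⟨haL, haB⟩ := Finset.mem_filter.1 ha
  obtain ⟨b, hb⟩ := h2
  obtain ⟨hbA, hbL⟩ := Finset.mem_filter.1 hb
  have hsub : (Finset.univ.filter fun i => ∀ j ∈ Finset.univ, j < i → σ j < σ i) ⊆
      ((Finset.univ.filter fun i => ∀ s ∈ S, i < s) ∪
        (Finset.univ.filter fun i => ∀ s ∈ S, s < i)) ∪
      ((cross A B σ).filter fun i => ∀ j ∈ cross A B σ, j < i → σ j < σ i) ∪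
      (AL ∪ BL.image ⇑σ⁻¹) := by
    intro i hi
    have hrec : ∀ j, j < i → σ j < σ i := fun j => (Finset.mem_filter.1 hi).2 j (Finset.mem_univ _)
    simp only [Finset.mem_union, Finset.mem_filter, Finset.mem_univ, true_and, Finset.mem_image]
    by_cases hiS : i ∈ S
    · have hcase : i ∈ B → σ i ∈ BL := by
        intro hiB
        by_contra hn
        exact lt_asymm (hrec b (hAB b hbA i hiB)) (hBL _ hbL _ ((hmap i).2 hiS) hn)
      rcases Finset.mem_union.1 (hS hiS) with hiA | hiB
      · rcases Finset.mem_union.1 (hS ((hmap i).2 hiS)) with h | h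
        · refine Or.inr (Or.inl ?_)
          by_contra hn
          exact lt_asymm (hrec a (hAL a haL i hiS hn)) (hAB _ h _ haB)
        · exact Or.inl (Or.inr ⟨Finset.mem_filter.2 ⟨hiA, h⟩, fun j _ => hrec j⟩)
      · exact Or.inr (Or.inr ⟨σ i, hcase hiB, by simp⟩)
    · by_cases hlow : ∀ s ∈ S, i < s
      · exact Or.inl (Or.inl (Or.inl hlow))
      by_cases hhigh : ∀ s ∈ S, s < i
      · exact Or.inl (Or.inl (Or.inr hhigh))
      -- A fixed record `i` strictly between `p` and `q` is impossible, by a chain of comparisons: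
      -- `σ p < i` with `σ p ∉ AL` forces `a < i`; then `b < σ a < i`; then `σ⁻¹ q < σ b < i`; hence
      -- `q < i`.
      exfalso
      have hne : ∀ s ∈ S, s ≠ i := fun s hs e => hiS (e ▸ hs)
      push Not at hlow hhigh
      obtain ⟨s, hs, hsi⟩ := hlow
      obtain ⟨s', hs', hsi'⟩ := hhigh
      have hpi : p < i := lt_of_le_of_ne ((hpmin s hs).trans hsi) (hne p hp)
      have hiq : i < q := lt_of_le_of_ne (hsi'.trans (hqmax s' hs')) (hne q hq).symm
      rw [hfix i hiS] at hrec
      have hai : a < i := by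
        by_contra hn
        exact lt_asymm (hrec p hpi)
          ((lt_of_le_of_ne (not_lt.1 hn) (hne a (hA (hALA haL))).symm).trans
            (hAL a haL _ ((hmap p).2 hp) h3))
      have hbi : b < i := (hAB b hbA _ haB).trans (hrec a hai)
      have hqS : σ⁻¹ q ∈ S := by rw [← hmap]; simpa using hq
      have hqi : σ⁻¹ q < i := (hBL _ hbL _ hqS h4).trans (hrec b hbi)
      have := hrec _ hqi
      simp only [Equiv.Perm.inv_def, Equiv.apply_symm_apply] at this
      exact lt_asymm this hiq
  have hrecM := recOn_eq_card σ (cross A B σ)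
  have hrecU := recOn_eq_card σ Finset.univ
  rw [hrecM, hrecU]
  refine (Finset.card_le_card hsub).trans ((Finset.card_union_le _ _).trans ?_)
  refine Nat.add_le_add ((Finset.card_union_le _ _).trans ?_) ((Finset.card_union_le _ _).trans
    (Nat.add_le_add_left Finset.card_image_le _))
  exact Nat.add_le_add_right (Finset.card_union_le _ _) _

end Sandwich

/-- The parts of `S` used to compare the records of a permutation with support `S` with those among
the elements sent from the lower half `A` to the upper half `B`. -/
theorem exists_halves {α : Type*} [LinearOrder α] (S : Finset α) {L : ℕ} (hL : 2 * L ≤ S.card) :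
    ∃ A B AL BL : Finset α, A ⊆ S ∧ B ⊆ S ∧ S ⊆ A ∪ B ∧ Disjoint A B ∧
      (∀ x ∈ A, ∀ y ∈ B, x < y) ∧ AL ⊆ A ∧ BL ⊆ B ∧
      (∀ x ∈ AL, ∀ y ∈ S, y ∉ AL → x < y) ∧ (∀ y ∈ BL, ∀ x ∈ S, x ∉ BL → x < y) ∧
      A.card = S.card / 2 ∧ B.card = S.card - S.card / 2 ∧ AL.card = L ∧ BL.card = L := by
  obtain ⟨A, hAS, hA, hlow⟩ := exists_lower_subset S (Nat.div_le_self S.card 2)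
  obtain ⟨AL, hALA, hAL, hALlow⟩ := exists_lower_subset A (k := L) (by omega)
  have hB : (S \ A).card = S.card - S.card / 2 := by rw [Finset.card_sdiff_of_subset hAS, hA]
  -- The top segment `BL` is the complement in `S \ A` of an initial segment `T`.
  obtain ⟨T, hTB, hT, hTlow⟩ := exists_lower_subset (S \ A) (k := S.card - S.card / 2 - L) (by omega)
  refine ⟨A, S \ A, AL, (S \ A) \ T, hAS, Finset.sdiff_subset, ?_, Finset.disjoint_sdiff,
    ?_, hALA, Finset.sdiff_subset, ?_, ?_, hA, hB, hAL, ?_⟩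
  · rw [Finset.union_sdiff_of_subset hAS]
  · intro x hx y hy
    rw [Finset.mem_sdiff] at hy
    exact hlow x hx y hy.1 hy.2
  · intro x hx y hy hyn
    by_cases hyA : y ∈ A
    · exact hALlow x hx y hyA hyn
    · exact hlow x (hALA hx) y hy hyA
  · intro y hy x hx hxn
    rw [Finset.mem_sdiff] at hy hxn
    by_cases hxA : x ∈ A
    · exact hlow x hxA y (Finset.mem_sdiff.1 hy.1).1 (Finset.mem_sdiff.1 hy.1).2
    · exact hTlow x (by
        by_contra h
        exact hxn ⟨Finset.mem_sdiff.2 ⟨hx, hxA⟩, h⟩) y hy.1 hy.2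
  · rw [Finset.card_sdiff_of_subset hTB, hB, hT]; omega

/-! ### Gaussian estimate for the record generating function -/

theorem norm_cexp_sub_cexp_le {a b : ℂ} (ha : a.re ≤ 0) (hb : b.re ≤ 0) :
    ‖Complex.exp a - Complex.exp b‖ ≤ ‖a - b‖ := by
  have hconv : Convex ℝ {z : ℂ | z.re ≤ 0} := convex_halfSpace_re_le 0
  have := hconv.norm_image_sub_le_of_norm_deriv_le (f := Complex.exp) (C := 1) (𝕜 := ℂ)
    (fun x _ => Complex.differentiable_exp x) (fun x hx => by
      rw [Complex.deriv_exp, Complex.norm_exp]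
      exact Real.exp_le_one_iff.2 hx) (x := b) (y := a) hb ha
  simpa using this

/-- Telescoping: factors of norm at most `1` let the individual errors simply add up. -/
theorem norm_prod_range_sub_le {a b : ℕ → ℂ} (ha : ∀ j, ‖a j‖ ≤ 1) (hb : ∀ j, ‖b j‖ ≤ 1) (k : ℕ) :
    ‖∏ j ∈ Finset.range k, a j - ∏ j ∈ Finset.range k, b j‖ ≤
      ∑ j ∈ Finset.range k, ‖a j - b j‖ := by
  induction k with
  | zero => simp
  | succ k ih =>
    rw [Finset.prod_range_succ, Finset.prod_range_succ, Finset.sum_range_succ]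
    have hP : ‖∏ j ∈ Finset.range k, b j‖ ≤ 1 := by
      rw [norm_prod]
      exact Finset.prod_le_one (fun _ _ => norm_nonneg _) fun j _ => hb j
    calc _ = ‖(∏ j ∈ Finset.range k, a j - ∏ j ∈ Finset.range k, b j) * a k +
          (∏ j ∈ Finset.range k, b j) * (a k - b k)‖ := by congr 1; ring
      _ ≤ ‖∏ j ∈ Finset.range k, a j - ∏ j ∈ Finset.range k, b j‖ * ‖a k‖ +
          ‖∏ j ∈ Finset.range k, b j‖ * ‖a k - b k‖ := by
        refine (norm_add_le _ _).trans ?_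
        rw [norm_mul, norm_mul]
      _ ≤ _ := by
        refine add_le_add ((mul_le_of_le_one_right (norm_nonneg _) (ha k)).trans ih) ?_
        exact mul_le_of_le_one_left (norm_nonneg _) hP

theorem sum_range_one_div_sq_le (k : ℕ) :
    ∑ j ∈ Finset.range k, 1 / ((j : ℝ) + 1) ^ 2 ≤ 2 - 1 / (k : ℝ) := by
  induction k with
  | zero => simp
  | succ k ih =>
    rw [Finset.sum_range_succ]
    rcases Nat.eq_zero_or_pos k with rfl | hk
    · norm_num
    have hk' : (0 : ℝ) < k := Nat.cast_pos.2 hk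
    have h : 1 / ((k : ℝ) + 1) ^ 2 ≤ 1 / k - 1 / ((k : ℝ) + 1) := by
      rw [div_sub_div _ _ hk'.ne' (by positivity), div_le_div_iff₀ (by positivity) (by positivity)]
      nlinarith
    push_cast
    linarith

theorem norm_add_natCast_div_le_one {w : ℂ} (hw : ‖w‖ ≤ 1) (j : ℕ) :
    ‖(w + j) / ((j : ℂ) + 1)‖ ≤ 1 := by
  have : ‖(j : ℂ) + 1‖ = j + 1 := by
    have := Complex.norm_natCast (j + 1)
    push_cast at this
    exact this
  rw [norm_div, this]
  refine div_le_one_of_le₀ ((norm_add_le _ _).trans ?_) (by positivity)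
  rw [Complex.norm_natCast, add_comm]
  gcongr

theorem norm_recordPGF_le_one {w : ℂ} (hw : ‖w‖ ≤ 1) (k : ℕ) : ‖recordPGF k w‖ ≤ 1 := by
  rw [recordPGF, norm_prod]
  exact Finset.prod_le_one (fun _ _ => norm_nonneg _) fun j _ => norm_add_natCast_div_le_one hw j

/-- Poisson approximation. Each factor is `1 + (w - 1) / (j + 1)`, which differs from the
exponential of `(w - 1) / (j + 1)` by at most `‖w - 1‖ ^ 2 / (j + 1) ^ 2`. These bounds sum to at
most `2 * ‖w - 1‖ ^ 2`, and the exponents sum to a harmonic number. -/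
theorem norm_recordPGF_sub_exp_le (k : ℕ) {w : ℂ} (hw : ‖w‖ = 1) (hw1 : ‖w - 1‖ ≤ 1) :
    ‖recordPGF k w - Complex.exp ((w - 1) * (harmonic k : ℝ))‖ ≤ 2 * ‖w - 1‖ ^ 2 := by
  have hre : (w - 1).re ≤ 0 := by
    have := Complex.re_le_norm w
    rw [hw] at this
    simpa using this
  have hb1 : ∀ j : ℕ, ‖Complex.exp ((w - 1) / (j + 1))‖ ≤ 1 := fun j => by
    rw [Complex.norm_exp, Real.exp_le_one_iff]
    have : (w - 1) / ((j : ℂ) + 1) = (w - 1) / ((j + 1 : ℝ) : ℂ) := by push_cast; rfl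
    rw [this, Complex.div_ofReal_re]
    exact div_nonpos_of_nonpos_of_nonneg hre (by positivity)
  have ha1 := norm_add_natCast_div_le_one hw.le
  have hexp : Complex.exp ((w - 1) * (harmonic k : ℝ)) =
      ∏ j ∈ Finset.range k, Complex.exp ((w - 1) / (j + 1)) := by
    rw [← Complex.exp_sum, harmonic]
    congr 1
    push_cast
    rw [Finset.mul_sum]
    rfl
  rw [hexp, recordPGF]
  refine (norm_prod_range_sub_le ha1 hb1 k).trans ?_
  have hj : ∀ j ∈ Finset.range k, ‖(w + j) / ((j : ℂ) + 1) - Complex.exp ((w - 1) / (j + 1))‖ ≤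
      ‖w - 1‖ ^ 2 * (1 / ((j : ℝ) + 1) ^ 2) := by
    intro j _
    have hj0 : (j : ℂ) + 1 ≠ 0 := Nat.cast_add_one_ne_zero j
    have hn : ‖(w - 1) / ((j : ℂ) + 1)‖ = ‖w - 1‖ / (j + 1) := by
      have := Complex.norm_natCast (j + 1)
      push_cast at this
      rw [norm_div, this]
    have h1 : ‖(w - 1) / ((j : ℂ) + 1)‖ ≤ 1 := by
      rw [hn]
      refine div_le_one_of_le₀ (hw1.trans ?_) (by positivity)
      simp
    have h2 := Complex.norm_exp_sub_one_sub_id_le h1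
    rw [norm_sub_rev]
    have h3 : (w + j) / ((j : ℂ) + 1) = 1 + (w - 1) / (j + 1) := by field_simp; ring
    rw [h3, ← sub_sub]
    refine h2.trans (le_of_eq ?_)
    rw [hn, div_pow]; ring
  refine (Finset.sum_le_sum hj).trans ?_
  rw [← Finset.mul_sum, mul_comm]
  have := sum_range_one_div_sq_le k
  have h0 : (0 : ℝ) ≤ 1 / k := by positivity
  exact mul_le_mul_of_nonneg_right (by linarith) (sq_nonneg _)

/-- The record generating function at `exp (i u)`, normalised by `log m`, is Gaussian up to a small
error. -/
theorem norm_recordPGF_mul_exp_sub_le {k m : ℕ} {u : ℝ} (hu : |u| ≤ 1) (hm : 0 < m)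
    (hkm : k ≤ m) (hk : (m : ℝ) / 8 ≤ k) :
    ‖recordPGF k (Complex.exp (u * Complex.I)) * Complex.exp (-(u * Real.log m) * Complex.I) -
        Real.exp (-(u ^ 2 * Real.log m) / 2)‖ ≤
      2 * u ^ 2 + |u| ^ 3 * (1 + Real.log m) + 3 * (|u| + u ^ 2) := by
  set w := Complex.exp (u * Complex.I) with hw
  set ℓ := Real.log m with hℓ
  set H : ℝ := (harmonic k : ℝ) with hH
  have hm0 : (0 : ℝ) < m := Nat.cast_pos.2 hm
  have hk0 : (0 : ℝ) < k := lt_of_lt_of_le (by positivity) hk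
  have hlogk : Real.log k ≤ ℓ := Real.log_le_log hk0 (Nat.cast_le.2 hkm)
  have hHle : H ≤ 1 + ℓ := (harmonic_le_one_add_log k).trans (by linarith)
  have hlog8 : Real.log 8 ≤ 3 := by
    have : Real.log 8 = 3 * Real.log 2 := by
      rw [show (8 : ℝ) = 2 ^ 3 by norm_num, Real.log_pow]; norm_num
    have := Real.log_two_lt_d9
    linarith
  have hHge : ℓ - 3 ≤ H := by
    have h1 : Real.log ((k + 1 : ℕ) : ℝ) ≤ H := log_add_one_le_harmonic k
    have h2 : Real.log k ≤ Real.log ((k + 1 : ℕ) : ℝ) := Real.log_le_log hk0 (by push_cast; linarith)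
    have h3 : Real.log (m / 8) ≤ Real.log k := Real.log_le_log (by positivity) hk
    rw [Real.log_div hm0.ne' (by norm_num)] at h3
    linarith
  have hH0 : 0 ≤ H := by rw [hH]; simp only [harmonic]; push_cast; positivity
  have hHlog : |H - ℓ| ≤ 3 := abs_le.2 ⟨by linarith, by linarith⟩
  have hwn : ‖w‖ = 1 := Complex.norm_exp_ofReal_mul_I u
  have hw1 : ‖w - 1‖ ≤ |u| := by
    have := Real.norm_exp_I_mul_ofReal_sub_one_le (x := u)
    rw [mul_comm] at this
    simpa using this
  have hsq : ‖w - 1‖ ^ 2 ≤ u ^ 2 := by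
    rw [← sq_abs u]; exact pow_le_pow_left₀ (norm_nonneg _) hw1 2
  have hre : (w - 1).re ≤ 0 := by
    have := Complex.re_le_norm w
    rw [hwn] at this
    simpa using this
  have hn1 : ‖Complex.exp (-(u * ℓ) * Complex.I)‖ = 1 := by
    have := Complex.norm_exp_ofReal_mul_I (-(u * ℓ))
    push_cast at this
    exact this
  have hstep1 : ‖recordPGF k w * Complex.exp (-(u * ℓ) * Complex.I) -
      Complex.exp ((w - 1) * H + -(u * ℓ) * Complex.I)‖ ≤ 2 * u ^ 2 := by
    rw [Complex.exp_add, ← sub_mul, norm_mul, hn1, mul_one]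
    exact (norm_recordPGF_sub_exp_le k hwn (hw1.trans hu)).trans (by linarith)
  have hw3 : ‖w - 1 - u * Complex.I + u ^ 2 / 2‖ ≤ |u| ^ 3 := by
    have h1 : ‖(u * Complex.I : ℂ)‖ = |u| := by simp
    have h := Complex.exp_bound (x := u * Complex.I) (by rw [h1]; exact hu) (n := 3) (by norm_num)
    rw [h1] at h
    have h2 : Complex.exp (u * Complex.I) - ∑ m ∈ Finset.range 3, (u * Complex.I) ^ m / m.factorial
        = w - 1 - u * Complex.I + u ^ 2 / 2 := by
      simp only [Finset.sum_range_succ, Finset.sum_range_zero, Nat.factorial]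
      rw [← hw, mul_pow _ _ 2, Complex.I_sq]
      push_cast
      ring
    rw [h2] at h
    refine h.trans ?_
    have : (0 : ℝ) ≤ |u| ^ 3 := by positivity
    norm_num [Nat.factorial]
    linarith
  have hstep2 : ‖Complex.exp ((w - 1) * H + -(u * ℓ) * Complex.I) -
      Real.exp (-(u ^ 2 * ℓ) / 2)‖ ≤ |u| ^ 3 * (1 + ℓ) + 3 * (|u| + u ^ 2) := by
    rw [Complex.ofReal_exp]
    have hlogm : 0 ≤ ℓ := Real.log_natCast_nonneg m
    refine (norm_cexp_sub_cexp_le ?_ ?_).trans ?_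
    · have h1 : ((w - 1) * (H : ℂ)).re = (w - 1).re * H := Complex.re_mul_ofReal _ _
      have h2 : (-(u * ℓ) * Complex.I : ℂ).re = 0 := by
        have := Complex.re_ofReal_mul (-(u * ℓ)) Complex.I
        push_cast at this
        rw [this]; simp
      rw [Complex.add_re, h1, h2, add_zero]
      exact mul_nonpos_of_nonpos_of_nonneg hre hH0
    · rw [Complex.ofReal_re]
      have : 0 ≤ u ^ 2 * ℓ := by positivity
      linarith
    -- The Taylor remainder of `w` is multiplied by `H ≤ 1 + ℓ`, the main term by `H - ℓ`, which is
    -- bounded by `3` because `m / 8 ≤ k ≤ m`.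
    · have : (w - 1) * H + -(u * ℓ) * Complex.I - ((-(u ^ 2 * ℓ) / 2 : ℝ) : ℂ) =
          (w - 1 - u * Complex.I + u ^ 2 / 2) * H +
            (u * Complex.I - u ^ 2 / 2) * ((H - ℓ : ℝ) : ℂ) := by
        push_cast; ring
      rw [this]
      refine (norm_add_le _ _).trans ?_
      rw [norm_mul, norm_mul, Complex.norm_real, Complex.norm_real, Real.norm_eq_abs,
        Real.norm_eq_abs, abs_of_nonneg hH0]
      refine add_le_add (mul_le_mul hw3 hHle hH0 (by positivity)) ?_
      rw [mul_comm]
      refine mul_le_mul hHlog ?_ (norm_nonneg _) (by norm_num)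
      refine (norm_sub_le _ _).trans ?_
      have h1 : ‖(u * Complex.I : ℂ)‖ = |u| := by simp
      have h2 : ‖(u ^ 2 / 2 : ℂ)‖ = u ^ 2 / 2 := by
        rw [norm_div, norm_pow, Complex.norm_real, Real.norm_eq_abs, sq_abs]; simp
      rw [h1, h2]
      have : 0 ≤ u ^ 2 := sq_nonneg u
      linarith
  calc _ ≤ _ := norm_sub_le_norm_sub_add_norm_sub _ _ _
    _ ≤ _ := add_le_add hstep1 hstep2
    _ = _ := by ring

/-! ### Gaussian approximation for a given support -/

namespace IsConjStable

variable {α : Type*} [LinearOrder α] [Fintype α] {C : Finset (Equiv.Perm α)} {S : Finset α}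

/-- The comparison fails only if no element crosses from `AL` to `B`, none from `A` to `BL`, the
minimum of `S` is sent into `AL`, or the maximum comes from `BL`. The two crossing numbers have mean
at least `L / 2`, and Chebyshev's inequality gives `8 / L + 24 / S.card` for each; the two remaining
events cost `L / (S.card - 1)` each. -/
theorem card_filter_not_sandwich_le (h : IsConjStable C S) {A B AL BL : Finset α} {L : ℕ}
    (hL : 0 < L) (hm : 8 ≤ S.card) (hA : A ⊆ S) (hB : B ⊆ S) (hS : S ⊆ A ∪ B)
    (hd : Disjoint A B) (hAB : ∀ x ∈ A, ∀ y ∈ B, x < y) (hALA : AL ⊆ A) (hBLB : BL ⊆ B)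
    (hAL : ∀ x ∈ AL, ∀ y ∈ S, y ∉ AL → x < y) (hBL : ∀ y ∈ BL, ∀ x ∈ S, x ∉ BL → x < y)
    (hAc : A.card = S.card / 2) (hBc : B.card = S.card - S.card / 2) (hALc : AL.card = L)
    (hBLc : BL.card = L) :
    ((C.filter fun σ : Equiv.Perm α => ¬ (lowGap S + highGap S + recOn σ (cross A B σ) ≤ recOn σ Finset.univ ∧
      recOn σ Finset.univ ≤ lowGap S + highGap S + recOn σ (cross A B σ) + 2 * L)).card : ℝ) ≤
      (16 / L + 48 / S.card + 2 * L / ((S.card : ℝ) - 1)) * C.card := by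
  classical
  have hne : S.Nonempty := Finset.card_pos.1 (by omega)
  set m := (S.card : ℝ) with hmdef
  have hm8 : (8 : ℝ) ≤ m := by rw [hmdef]; exact_mod_cast hm
  have hm1 : 0 < m - 1 := by linarith
  have hL0 : (0 : ℝ) < L := Nat.cast_pos.2 hL
  set p := S.min' hne
  set q := S.max' hne
  have hp : p ∈ S := Finset.min'_mem _ _
  have hq : q ∈ S := Finset.max'_mem _ _
  have hsub : (C.filter fun σ : Equiv.Perm α => ¬ (lowGap S + highGap S + recOn σ (cross A B σ) ≤
        recOn σ Finset.univ ∧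
      recOn σ Finset.univ ≤ lowGap S + highGap S + recOn σ (cross A B σ) + 2 * L)) ⊆
      ((C.filter fun σ : Equiv.Perm α => ((cross AL B σ).card : ℝ) ≤ (L * B.card / (m - 1)) / 2) ∪
        (C.filter fun σ : Equiv.Perm α => ((cross A BL σ).card : ℝ) ≤ (A.card * L / (m - 1)) / 2)) ∪
      ((C.filter fun σ : Equiv.Perm α => σ p ∈ AL) ∪ (C.filter fun σ => σ⁻¹ q ∈ BL)) := by
    intro σ hσ
    obtain ⟨hσC, hσ⟩ := Finset.mem_filter.1 hσ
    by_contra hn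
    simp only [Finset.mem_union, Finset.mem_filter, hσC, true_and, not_or, not_le] at hn
    obtain ⟨⟨h1, h2⟩, h3, h4⟩ := hn
    refine hσ ⟨le_recOn_univ (h.support_eq σ hσC) hne hA hS hAB, ?_⟩
    have h1' : (cross AL B σ).Nonempty := Finset.card_pos.1 (by
      have : (0 : ℝ) < (cross AL B σ).card := lt_of_le_of_lt (by positivity) h1
      exact_mod_cast this)
    have h2' : (cross A BL σ).Nonempty := Finset.card_pos.1 (by
      have : (0 : ℝ) < (cross A BL σ).card := lt_of_le_of_lt (by positivity) h2
      exact_mod_cast this)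
    have := recOn_univ_le (h.support_eq σ hσC) hS hA hAB hALA hAL hBL hp
      (fun s hs => Finset.min'_le _ _ hs) hq (fun s hs => Finset.le_max' _ _ hs) h1' h2' h3 h4
    rw [hALc, hBLc] at this
    omega
  have hAr : (m - 1) / 2 ≤ A.card := by
    have : S.card ≤ 2 * A.card + 1 := by omega
    have : (m : ℝ) ≤ 2 * A.card + 1 := by rw [hmdef]; exact_mod_cast this
    linarith
  have hBr : (m - 1) / 2 ≤ B.card := by
    have : S.card ≤ 2 * B.card + 1 := by omega
    have : (m : ℝ) ≤ 2 * B.card + 1 := by rw [hmdef]; exact_mod_cast this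
    linarith
  have hmu : ∀ μ : ℝ, L / 2 ≤ μ → 4 * (1 / μ + 6 / m) * C.card ≤ (8 / L + 24 / m) * C.card := by
    intro μ hμ
    have : 1 / μ ≤ 2 / L := by
      rw [div_le_div_iff₀ (by linarith) hL0]; linarith
    refine mul_le_mul_of_nonneg_right ?_ (Nat.cast_nonneg _)
    have e1 : 8 / (L : ℝ) = 4 * (2 / L) := by ring
    have e2 : 24 / m = 4 * (6 / m) := by ring
    rw [e1, e2]; linarith
  have hmu1 : (L : ℝ) / 2 ≤ L * B.card / (m - 1) := by
    rw [le_div_iff₀ hm1]; nlinarith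
  have hmu2 : (L : ℝ) / 2 ≤ A.card * L / (m - 1) := by
    rw [le_div_iff₀ hm1]; nlinarith
  have c1 := (h.card_filter_cross_le (hALA.trans hA) hB
    (Finset.disjoint_of_subset_left hALA hd) hm (lt_of_lt_of_le (by positivity) hmu1)
    (by rw [hALc])).trans (hmu _ hmu1)
  have c2 := (h.card_filter_cross_le hA (hBLB.trans hB)
    (Finset.disjoint_of_subset_right hBLB hd) hm (lt_of_lt_of_le (by positivity) hmu2)
    (by rw [hBLc])).trans (hmu _ hmu2)
  have c3 : ((C.filter fun σ : Equiv.Perm α => σ p ∈ AL).card : ℝ) ≤ L / (m - 1) * C.card := by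
    have := h.card_filter_apply_mem_le hp (hALA.trans hA)
    rw [hALc] at this
    rw [div_mul_eq_mul_div, le_div_iff₀ hm1]
    linarith
  have c4 : ((C.filter fun σ : Equiv.Perm α => σ⁻¹ q ∈ BL).card : ℝ) ≤ L / (m - 1) * C.card := by
    have := h.card_filter_inv_apply_mem_le hq (hBLB.trans hB)
    rw [hBLc] at this
    rw [div_mul_eq_mul_div, le_div_iff₀ hm1]
    linarith
  have hcard := (Finset.card_le_card hsub).trans ((Finset.card_union_le _ _).trans
    (add_le_add (Finset.card_union_le _ _) (Finset.card_union_le _ _)))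
  have hcard' : ((C.filter fun σ : Equiv.Perm α => ¬ (lowGap S + highGap S + recOn σ (cross A B σ) ≤
        recOn σ Finset.univ ∧
      recOn σ Finset.univ ≤ lowGap S + highGap S + recOn σ (cross A B σ) + 2 * L)).card : ℝ) ≤ _ :=
    Nat.cast_le.2 hcard
  refine hcard'.trans ?_
  push_cast
  refine (add_le_add (add_le_add c1 c2) (add_le_add c3 c4)).trans (le_of_eq ?_)
  ring

/-- The mean number of crossings is at least `S.card / 4`, so this is again Chebyshev's inequality
at half the mean. -/
theorem card_filter_cross_lt (h : IsConjStable C S) {A B : Finset α}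
    (hm : 8 ≤ S.card) (hA : A ⊆ S) (hB : B ⊆ S) (hd : Disjoint A B)
    (hAc : A.card = S.card / 2) (hBc : B.card = S.card - S.card / 2) :
    ((C.filter fun σ : Equiv.Perm α => ¬ (S.card : ℝ) / 8 ≤ (cross A B σ).card).card : ℝ) ≤
      40 / S.card * C.card := by
  have hm8 : (8 : ℝ) ≤ S.card := by exact_mod_cast hm
  have hm1 : (0 : ℝ) < S.card - 1 := by linarith
  have hμ : (S.card : ℝ) / 4 ≤ A.card * B.card / ((S.card : ℝ) - 1) := by
    rw [le_div_iff₀ hm1]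
    obtain ⟨a, ha⟩ : ∃ a, a = S.card / 2 := ⟨_, rfl⟩
    rw [hAc, hBc, ← ha]
    rcases Nat.even_or_odd' S.card with ⟨b, hb | hb⟩
    · rw [show a = b by omega, show S.card - b = b by omega, hb]; push_cast; nlinarith
    · rw [show a = b by omega, show S.card - b = b + 1 by omega, hb]; push_cast; nlinarith
  have hμ0 : 0 < (S.card : ℝ) / 4 := by linarith
  have := h.card_filter_cross_le hA hB hd hm (hμ0.trans_le hμ) rfl
  refine le_trans (Nat.cast_le.2 (Finset.card_le_card ?_)) (this.trans ?_)
  · intro σ hσ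
    rw [Finset.mem_filter] at hσ ⊢
    refine ⟨hσ.1, (not_le.1 hσ.2).le.trans ?_⟩
    linarith
  · refine mul_le_mul_of_nonneg_right ?_ (Nat.cast_nonneg _)
    have h1 : 1 / ((A.card : ℝ) * B.card / ((S.card : ℝ) - 1)) ≤ 1 / ((S.card : ℝ) / 4) :=
      one_div_le_one_div_of_le hμ0 hμ
    have h2 : 1 / ((S.card : ℝ) / 4) = 4 / S.card := by rw [one_div_div]
    have h3 : (40 : ℝ) / S.card = 4 * (4 / S.card + 6 / S.card) := by ring
    rw [h3, ← h2]
    linarith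

end IsConjStable

theorem norm_exp_mul_I_sub_le (u x y : ℝ) :
    ‖Complex.exp ((u * x : ℝ) * Complex.I) - Complex.exp ((u * y : ℝ) * Complex.I)‖ ≤
      |u| * |x - y| := by
  refine (norm_cexp_sub_cexp_le (by simp) (by simp)).trans (le_of_eq ?_)
  rw [← sub_mul, norm_mul, Complex.norm_I, mul_one, ← Complex.ofReal_sub, Complex.norm_real,
    ← mul_sub, norm_mul, Real.norm_eq_abs, Real.norm_eq_abs]

theorem norm_sum_sub_sum_le_of_filter {ι : Type*} (s : Finset ι) (f g : ι → ℂ) (p : ι → Prop)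
    [DecidablePred p] {ε η : ℝ} (hε : 0 ≤ ε) (hf : ∀ i ∈ s, ‖f i‖ ≤ 1) (hg : ∀ i ∈ s, ‖g i‖ ≤ 1)
    (hfg : ∀ i ∈ s, p i → ‖f i - g i‖ ≤ ε)
    (hp : ((s.filter fun i => ¬ p i).card : ℝ) ≤ η * s.card) :
    ‖∑ i ∈ s, f i - ∑ i ∈ s, g i‖ ≤ (ε + 2 * η) * s.card := by
  rw [← Finset.sum_sub_distrib]
  calc _ ≤ ∑ i ∈ s, (ε + 2 * if ¬ p i then 1 else 0) := by
        refine norm_sum_le_of_le _ fun i hi => ?_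
        by_cases h : p i
        · simpa [h] using hfg i hi h
        · have := (norm_sub_le (f i) (g i)).trans (add_le_add (hf i hi) (hg i hi))
          simp only [h, not_false_eq_true, if_true]
          linarith
    _ = ε * s.card + 2 * (s.filter fun i => ¬ p i).card := by
        rw [Finset.sum_add_distrib, ← Finset.mul_sum, Finset.sum_const, nsmul_eq_mul, mul_comm,
          Finset.sum_boole]
    _ ≤ _ := by linarith

/-- The error in the Gaussian approximation of the characteristic function of the number of records
of a uniform permutation with `m` non-fixed points. -/
noncomputable def recordError (m L : ℕ) (u : ℝ) : ℝ :=
  (2 * u ^ 2 + |u| ^ 3 * (1 + Real.log m) + 3 * (|u| + u ^ 2) + 2 * (40 / m)) +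
    (|u| * (2 * L) + 2 * (16 / L + 48 / m + 2 * L / ((m : ℝ) - 1)))

/-- Two replacements: all records by gaps plus crossing records, at cost `|u| * (2 * L)` off the bad
event; then the crossing records by their generating function, which is nearly Gaussian when the
crossing set has at least `S.card / 8` elements. Each bad event costs twice its probability. -/
theorem IsConjStable.norm_sum_exp_recOn_sub_le {α : Type*} [LinearOrder α] [Fintype α]
    {C : Finset (Equiv.Perm α)} {S : Finset α} (h : IsConjStable C S) {L : ℕ} (hL : 0 < L)
    (hLS : 2 * L ≤ S.card) (hm : 8 ≤ S.card) {u : ℝ} (hu : |u| ≤ 1) :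
    ‖∑ σ ∈ C, Complex.exp ((u * ((recOn σ Finset.univ : ℝ) - (lowGap S + highGap S : ℕ) -
        Real.log S.card) : ℝ) * Complex.I) - C.card * Real.exp (-(u ^ 2 * Real.log S.card) / 2)‖ ≤
      recordError S.card L u * C.card := by
  obtain ⟨A, B, AL, BL, hA, hB, hS, hd, hAB, hALA, hBLB, hAL, hBL, hAc, hBc, hALc, hBLc⟩ :=
    exists_halves S hLS
  set ℓ := Real.log S.card with hℓ
  have hℓ0 : 0 ≤ ℓ := Real.log_natCast_nonneg _
  have hm0 : 0 < S.card := by omega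
  have hbad := h.card_filter_not_sandwich_le hL hm hA hB hS hd hAB hALA hBLB hAL hBL hAc hBc hALc
    hBLc
  have hsmall := h.card_filter_cross_lt hm hA hB hd hAc hBc
  set w := Complex.exp (u * Complex.I) with hw
  have hwn : ‖w‖ = 1 := Complex.norm_exp_ofReal_mul_I u
  have hen : ‖Complex.exp (-(u * ℓ) * Complex.I)‖ = 1 := by
    have := Complex.norm_exp_ofReal_mul_I (-(u * ℓ))
    push_cast at this
    exact this
  have hstep1 := norm_sum_sub_sum_le_of_filter C
    (fun σ => Complex.exp ((u * ((recOn σ Finset.univ : ℝ) - (lowGap S + highGap S : ℕ) - ℓ) : ℝ) *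
      Complex.I))
    (fun σ => Complex.exp ((u * ((recOn σ (cross A B σ) : ℝ) - ℓ) : ℝ) * Complex.I))
    (fun σ => lowGap S + highGap S + recOn σ (cross A B σ) ≤ recOn σ Finset.univ ∧
      recOn σ Finset.univ ≤ lowGap S + highGap S + recOn σ (cross A B σ) + 2 * L)
    (ε := |u| * (2 * L)) (by positivity) (fun σ _ => (Complex.norm_exp_ofReal_mul_I _).le)
    (fun σ _ => (Complex.norm_exp_ofReal_mul_I _).le) (fun σ _ hσ => ?_) hbad
  swap
  · refine (norm_exp_mul_I_sub_le _ _ _).trans (mul_le_mul_of_nonneg_left ?_ (abs_nonneg u))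
    have h1 : ((lowGap S + highGap S : ℕ) : ℝ) + recOn σ (cross A B σ) ≤ recOn σ Finset.univ := by
      exact_mod_cast hσ.1
    have h2 : (recOn σ Finset.univ : ℝ) ≤
        ((lowGap S + highGap S : ℕ) : ℝ) + recOn σ (cross A B σ) + 2 * L := by
      exact_mod_cast hσ.2
    rw [abs_le]
    constructor <;> linarith
  have hpgf : ∑ σ ∈ C, Complex.exp ((u * ((recOn σ (cross A B σ) : ℝ) - ℓ) : ℝ) * Complex.I) =
      ∑ σ ∈ C, recordPGF (cross A B σ).card w * Complex.exp (-(u * ℓ) * Complex.I) := by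
    rw [← Finset.sum_mul, ← sum_pow_recOn_cross C A B hd
      (fun σ hσ π hπ => h.conj_mem σ hσ π (hπ.trans hB)), Finset.sum_mul]
    refine Finset.sum_congr rfl fun σ _ => ?_
    rw [hw, ← Complex.exp_nat_mul, ← Complex.exp_add]
    congr 1
    push_cast
    ring
  have hstep2 := norm_sum_sub_sum_le_of_filter C
    (fun σ => recordPGF (cross A B σ).card w * Complex.exp (-(u * ℓ) * Complex.I))
    (fun _ => ((Real.exp (-(u ^ 2 * ℓ) / 2) : ℝ) : ℂ))
    (fun σ => (S.card : ℝ) / 8 ≤ (cross A B σ).card)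
    (ε := 2 * u ^ 2 + |u| ^ 3 * (1 + ℓ) + 3 * (|u| + u ^ 2)) (by positivity) (fun σ _ => ?_)
    (fun σ _ => ?_)
    (fun σ _ hσ => norm_recordPGF_mul_exp_sub_le hu hm0
      ((Finset.card_le_card ((Finset.filter_subset _ _).trans hA))) hσ) hsmall
  rotate_left
  · rw [norm_mul, hen, mul_one]
    exact norm_recordPGF_le_one hwn.le _
  · rw [Complex.norm_real, Real.norm_eq_abs, Real.abs_exp, Real.exp_le_one_iff]
    have : 0 ≤ u ^ 2 * ℓ := by positivity
    linarith
  rw [Finset.sum_const, nsmul_eq_mul] at hstep2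
  rw [hpgf] at hstep1
  refine (norm_sub_le_norm_sub_add_norm_sub _ _ _).trans ((add_le_add hstep1 hstep2).trans
    (le_of_eq ?_))
  rw [recordError, ← hℓ]
  ring

/-! ### Extreme gaps of a uniform subset -/

theorem lowGap_eq_min' {n : ℕ} (S : Finset (Fin n)) (hS : S.Nonempty) :
    lowGap S = (S.min' hS : ℕ) := by
  rw [lowGap, ← Fin.card_Iio]
  congr 1
  ext i
  simp [Finset.lt_min'_iff]

theorem highGap_eq_max' {n : ℕ} (S : Finset (Fin n)) (hS : S.Nonempty) :
    highGap S = n - 1 - (S.max' hS : ℕ) := by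
  rw [highGap, ← Fin.card_Ioi]
  congr 1
  ext i
  simp [Finset.max'_lt_iff]

theorem lt_lowGap_iff {n : ℕ} (S : Finset (Fin n)) (hS : S.Nonempty) (a : ℕ) :
    a < lowGap S ↔ ∀ s ∈ S, a + 1 ≤ (s : ℕ) := by
  rw [lowGap_eq_min' S hS]
  constructor
  · intro h s hs
    exact lt_of_lt_of_le h (Finset.min'_le S s hs)
  · intro h
    exact h _ (Finset.min'_mem S hS)

theorem lt_highGap_iff {n : ℕ} (S : Finset (Fin n)) (hS : S.Nonempty) (b : ℕ) :
    b < highGap S ↔ ∀ s ∈ S, (s : ℕ) + (b + 1) < n := by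
  rw [highGap_eq_max' S hS]
  constructor
  · intro h s hs
    have : (s : ℕ) ≤ (S.max' hS : ℕ) := Finset.le_max' S s hs
    omega
  · intro h
    have := h _ (Finset.max'_mem S hS)
    omega

theorem card_filter_powersetCard_between (n m a b : ℕ) :
    ((Finset.powersetCard m (Finset.univ : Finset (Fin n))).filter fun S : Finset (Fin n) =>
      (∀ s ∈ S, a ≤ (s : ℕ)) ∧ ∀ s ∈ S, (s : ℕ) + b < n).card = (n - a - b).choose m := by
  have h1 : (Finset.univ.filter fun i : Fin n => a ≤ (i : ℕ) ∧ (i : ℕ) + b < n).card =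
      n - a - b := by
    rw [← Finset.card_map Fin.valEmbedding]
    have : (Finset.univ.filter fun i : Fin n => a ≤ (i : ℕ) ∧ (i : ℕ) + b < n).map
        Fin.valEmbedding = Finset.Ico a (n - b) := by
      ext k
      simp only [Finset.mem_map, Finset.mem_filter, Finset.mem_univ, true_and,
        Fin.valEmbedding_apply, Finset.mem_Ico]
      constructor
      · rintro ⟨i, hi, rfl⟩; omega
      · rintro ⟨h, h'⟩; exact ⟨⟨k, by omega⟩, ⟨h, by simp only; omega⟩, rfl⟩
    rw [this, Nat.card_Ico]; omega
  rw [← h1, ← Finset.card_powersetCard]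
  congr 1
  ext S
  simp only [Finset.mem_filter, Finset.mem_powersetCard, Finset.subset_iff, Finset.mem_univ,
    true_and, implies_true]
  exact ⟨fun h => ⟨fun x hx => ⟨h.2.1 x hx, h.2.2 x hx⟩, h.1⟩,
    fun h => ⟨h.2, fun x hx => (h.1 hx).1, fun x hx => (h.1 hx).2⟩⟩

theorem pow_eq_one_add_sum {R : Type*} [CommRing R] (z : R) {k n : ℕ} (hk : k ≤ n) :
    z ^ k = 1 + (z - 1) * ∑ a ∈ Finset.range n, z ^ a * if a < k then 1 else 0 := by
  have : ∑ a ∈ Finset.range n, z ^ a * (if a < k then (1 : R) else 0) =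
      ∑ a ∈ Finset.range k, z ^ a := by
    simp only [mul_ite, mul_one, mul_zero]
    rw [← Finset.sum_filter]
    congr 1
    ext a
    simp only [Finset.mem_filter, Finset.mem_range]
    omega
  rw [this, mul_geom_sum]
  ring

/-- Summation by parts on both gaps leaves only tail counts. Subsets whose low gap exceeds `a` and
whose high gap exceeds `b` are the `m`-subsets of an interval of `n - (a + 1) - (b + 1)` points. The
factor `2` reflects the equal laws of the two gaps. -/
theorem sum_pow_gap (n m : ℕ) (hm : 0 < m) (z : ℂ) :
    ∑ S ∈ Finset.powersetCard m (Finset.univ : Finset (Fin n)), z ^ (lowGap S + highGap S) =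
      n.choose m + 2 * (z - 1) * ∑ a ∈ Finset.range n, z ^ a * ((n - (a + 1)).choose m : ℂ) +
        (z - 1) ^ 2 * ∑ a ∈ Finset.range n, ∑ b ∈ Finset.range n,
          z ^ (a + b) * ((n - (a + 1) - (b + 1)).choose m : ℂ) := by
  set P := Finset.powersetCard m (Finset.univ : Finset (Fin n)) with hP
  have hne : ∀ S ∈ P, S.Nonempty := fun S hS => Finset.card_pos.1 (by
    rw [(Finset.mem_powersetCard.1 hS).2]; exact hm)
  have hl : ∀ S ∈ P, lowGap S ≤ n := fun S _ => (Finset.card_le_univ _).trans (by simp)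
  have hh : ∀ S ∈ P, highGap S ≤ n := fun S _ => (Finset.card_le_univ _).trans (by simp)
  have h0 : ∑ S ∈ P, (1 : ℂ) = n.choose m := by simp [hP]
  have h1 : ∀ a, ∑ S ∈ P, (if a < lowGap S then (1 : ℂ) else 0) = ((n - (a + 1)).choose m : ℂ) := by
    intro a
    rw [Finset.sum_boole, ← tsub_zero (n - (a + 1)), ← card_filter_powersetCard_between]
    congr 2
    refine Finset.filter_congr fun S hS => ?_
    simp [lt_lowGap_iff S (hne S hS)]
  have h2 : ∀ b, ∑ S ∈ P, (if b < highGap S then (1 : ℂ) else 0) =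
      ((n - (b + 1)).choose m : ℂ) := by
    intro b
    rw [Finset.sum_boole]
    have := card_filter_powersetCard_between n m 0 (b + 1)
    rw [tsub_zero] at this
    rw [← this]
    congr 2
    refine Finset.filter_congr fun S hS => ?_
    simp [lt_highGap_iff S (hne S hS)]
  have h3 : ∀ a b, ∑ S ∈ P, (if a < lowGap S then (1 : ℂ) else 0) *
      (if b < highGap S then (1 : ℂ) else 0) = ((n - (a + 1) - (b + 1)).choose m : ℂ) := by
    intro a b
    simp only [ite_zero_mul_ite_zero, mul_one]
    rw [Finset.sum_boole, ← card_filter_powersetCard_between]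
    congr 2
    refine Finset.filter_congr fun S hS => ?_
    rw [lt_lowGap_iff S (hne S hS), lt_highGap_iff S (hne S hS)]
  have hexp : ∀ S ∈ P, z ^ (lowGap S + highGap S) = 1 +
      (z - 1) * ∑ a ∈ Finset.range n, z ^ a * (if a < lowGap S then (1 : ℂ) else 0) +
      (z - 1) * ∑ b ∈ Finset.range n, z ^ b * (if b < highGap S then (1 : ℂ) else 0) +
      (z - 1) ^ 2 * ∑ a ∈ Finset.range n, ∑ b ∈ Finset.range n, z ^ (a + b) *
        ((if a < lowGap S then (1 : ℂ) else 0) * (if b < highGap S then (1 : ℂ) else 0)) := by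
    intro S hS
    have : ∑ a ∈ Finset.range n, ∑ b ∈ Finset.range n, z ^ (a + b) *
        ((if a < lowGap S then (1 : ℂ) else 0) * (if b < highGap S then (1 : ℂ) else 0)) =
        (∑ a ∈ Finset.range n, z ^ a * (if a < lowGap S then (1 : ℂ) else 0)) *
        ∑ b ∈ Finset.range n, z ^ b * (if b < highGap S then (1 : ℂ) else 0) := by
      rw [Finset.sum_mul_sum]
      refine Finset.sum_congr rfl fun a _ => Finset.sum_congr rfl fun b _ => ?_
      rw [pow_add]; ring
    rw [this, pow_add, pow_eq_one_add_sum z (hl S hS), pow_eq_one_add_sum z (hh S hS)]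
    ring
  rw [Finset.sum_congr rfl hexp, Finset.sum_add_distrib, Finset.sum_add_distrib,
    Finset.sum_add_distrib, h0, ← Finset.mul_sum, ← Finset.mul_sum, ← Finset.mul_sum]
  have e1 : ∑ S ∈ P, ∑ a ∈ Finset.range n, z ^ a * (if a < lowGap S then (1 : ℂ) else 0) =
      ∑ a ∈ Finset.range n, z ^ a * ((n - (a + 1)).choose m : ℂ) := by
    rw [Finset.sum_comm]
    exact Finset.sum_congr rfl fun a _ => by rw [← Finset.mul_sum, h1]
  have e2 : ∑ S ∈ P, ∑ a ∈ Finset.range n, z ^ a * (if a < highGap S then (1 : ℂ) else 0) =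
      ∑ a ∈ Finset.range n, z ^ a * ((n - (a + 1)).choose m : ℂ) := by
    rw [Finset.sum_comm]
    exact Finset.sum_congr rfl fun a _ => by rw [← Finset.mul_sum, h2]
  have e3 : ∑ S ∈ P, ∑ a ∈ Finset.range n, ∑ b ∈ Finset.range n, z ^ (a + b) *
        ((if a < lowGap S then (1 : ℂ) else 0) * (if b < highGap S then (1 : ℂ) else 0)) =
      ∑ a ∈ Finset.range n, ∑ b ∈ Finset.range n,
          z ^ (a + b) * ((n - (a + 1) - (b + 1)).choose m : ℂ) := by
    rw [Finset.sum_comm]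
    refine Finset.sum_congr rfl fun a _ => ?_
    rw [Finset.sum_comm]
    exact Finset.sum_congr rfl fun b _ => by rw [← Finset.mul_sum, h3]
  rw [e1, e2, e3]
  ring

/-- Hockey-stick identity; the terms with `a ≥ k` vanish because `0 < m`. -/
theorem sum_range_choose_sub {m : ℕ} (hm : 0 < m) {k N : ℕ} (hN : k ≤ N) :
    ∑ a ∈ Finset.range N, (k - (a + 1)).choose m = k.choose (m + 1) := by
  induction k generalizing N with
  | zero =>
    simp only [Nat.zero_sub, Nat.choose_zero_succ]
    exact Finset.sum_eq_zero fun _ _ => Nat.choose_eq_zero_of_lt hm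
  | succ k ih =>
    obtain ⟨N, rfl⟩ : ∃ N', N = N' + 1 := ⟨N - 1, by omega⟩
    rw [Finset.sum_range_succ', Nat.choose_succ_succ, ← ih (by omega : k ≤ N), add_comm]
    congr 1
    exact Finset.sum_congr rfl fun a _ => by rw [Nat.add_sub_add_right]

/-- Lowering the upper index from `k + 1` to `k` multiplies the binomial coefficient by `1 - m / (k
+ 1)`, which is at most `1 - m / n`. So the tails of the gaps are dominated by geometric ones. -/
theorem choose_sub_le {n m : ℕ} (hm : 0 < m) (hmn : m ≤ n) (g : ℕ) :
    ((n - g).choose m : ℝ) ≤ n.choose m * (((n : ℝ) - m) / n) ^ g := by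
  have hn : (0 : ℝ) < n := Nat.cast_pos.2 (hm.trans_le hmn)
  have hx : 0 ≤ ((n : ℝ) - m) / n :=
    div_nonneg (sub_nonneg.2 (Nat.cast_le.2 hmn)) hn.le
  induction g with
  | zero => simp
  | succ g ih =>
    have hstep : ((n - (g + 1)).choose m : ℝ) ≤ (n - g).choose m * (((n : ℝ) - m) / n) := by
      rcases lt_or_ge (n - g) m with h | h
      · rw [Nat.choose_eq_zero_of_lt h, Nat.choose_eq_zero_of_lt (by omega)]; simp
      · obtain ⟨k, hk⟩ : ∃ k, n - g = k + 1 := ⟨n - g - 1, by omega⟩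
        rw [show n - (g + 1) = k by omega, hk]
        rw [hk] at h
        have h1 := Nat.choose_mul_succ_eq k m
        have h2 : (k.choose m : ℝ) * (k + 1) = (k + 1).choose m * ((k : ℝ) + 1 - m) := by
          have := congrArg (Nat.cast : ℕ → ℝ) h1
          push_cast [Nat.cast_sub h] at this
          exact this
        have hk1 : (0 : ℝ) < (k : ℝ) + 1 := by positivity
        have h3 : (k.choose m : ℝ) = (k + 1).choose m * (((k : ℝ) + 1 - m) / (k + 1)) := by
          rw [mul_div_assoc', ← h2]; field_simp
        rw [h3]
        refine mul_le_mul_of_nonneg_left ?_ (Nat.cast_nonneg _)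
        have hkn : (k : ℝ) + 1 ≤ n := by
          have : k + 1 ≤ n := by omega
          exact_mod_cast this
        have hm' : (0 : ℝ) ≤ m := Nat.cast_nonneg _
        rw [div_le_div_iff₀ hk1 hn]
        nlinarith
    calc _ ≤ _ := hstep
      _ ≤ (n.choose m * (((n : ℝ) - m) / n) ^ g) * (((n : ℝ) - m) / n) :=
        mul_le_mul_of_nonneg_right ih hx
      _ = _ := by ring

theorem hasSum_mul_self {R : Type*} [NormedCommRing R] [CompleteSpace R] {f : ℕ → R} {s : R}
    (hf : HasSum f s) (hn : Summable fun a => ‖f a‖) :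
    HasSum (fun p : ℕ × ℕ => f p.1 * f p.2) (s * s) :=
  hf.mul hf (summable_mul_of_summable_norm hn hn)

/-- Since `q g ≤ x ^ g` termwise and `‖z‖ = 1`, the error at `z` is bounded by the error at `1`, a
difference of two sums that can be computed exactly. No rate of convergence of individual tails is
needed. -/
theorem norm_sum_sub_geometric_le {n : ℕ} {x : ℝ} {q : ℕ → ℝ} (hx0 : 0 ≤ x) (hx1 : x < 1)
    (hqx : ∀ g, q g ≤ x ^ g) (hq0 : ∀ g, n ≤ g → q g = 0) {z : ℂ} (hz : ‖z‖ = 1) :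
    ‖∑ a ∈ Finset.range n, z ^ a * (q (a + 1) : ℂ) - x * (1 - x * z)⁻¹‖ ≤
        x / (1 - x) - ∑ a ∈ Finset.range n, q (a + 1) ∧
      ‖∑ a ∈ Finset.range n, ∑ b ∈ Finset.range n, z ^ (a + b) * (q (a + 1 + (b + 1)) : ℂ) -
          (x * (1 - x * z)⁻¹) ^ 2‖ ≤
        (x / (1 - x)) ^ 2 - ∑ a ∈ Finset.range n, ∑ b ∈ Finset.range n, q (a + 1 + (b + 1)) := by
  have sx : HasSum (fun a : ℕ => x ^ (a + 1)) (x / (1 - x)) := by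
    have := (hasSum_geometric_of_lt_one hx0 hx1).mul_left x
    rw [← div_eq_mul_inv] at this
    simpa only [pow_succ'] using this
  have sx2 : HasSum (fun p : ℕ × ℕ => x ^ (p.1 + 1) * x ^ (p.2 + 1))
      (x / (1 - x) * (x / (1 - x))) :=
    hasSum_mul_self (f := fun a : ℕ => x ^ (a + 1)) sx sx.summable.norm
  have sq1 : HasSum (fun a : ℕ => q (a + 1)) (∑ a ∈ Finset.range n, q (a + 1)) :=
    hasSum_sum_of_ne_finset_zero fun a ha => by
      rw [Finset.mem_range] at ha
      exact hq0 (a + 1) (by omega)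
  have sq2 : HasSum (fun p : ℕ × ℕ => q (p.1 + 1 + (p.2 + 1)))
      (∑ p ∈ Finset.range n ×ˢ Finset.range n, q (p.1 + 1 + (p.2 + 1))) :=
    hasSum_sum_of_ne_finset_zero fun p hp => by
      simp only [Finset.mem_product, Finset.mem_range] at hp
      exact hq0 (p.1 + 1 + (p.2 + 1)) (by omega)
  have hxz : ‖(x : ℂ) * z‖ < 1 := by
    rw [norm_mul, hz, mul_one, Complex.norm_real, Real.norm_of_nonneg hx0]; exact hx1
  set F : ℂ := x * (1 - x * z)⁻¹ with hF
  have sf : HasSum (fun a : ℕ => z ^ a * (x : ℂ) ^ (a + 1)) F := by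
    have := (hasSum_geometric_of_norm_lt_one hxz).mul_left (x : ℂ)
    convert! this using 2 with a
    rw [mul_pow]; ring
  have hnf : ∀ a : ℕ, ‖z ^ a * (x : ℂ) ^ (a + 1)‖ = x ^ (a + 1) := fun a => by
    rw [norm_mul, norm_pow, hz, one_pow, one_mul, norm_pow, Complex.norm_real,
      Real.norm_of_nonneg hx0]
  have sf2 : HasSum (fun p : ℕ × ℕ => (z ^ p.1 * (x : ℂ) ^ (p.1 + 1)) *
      (z ^ p.2 * (x : ℂ) ^ (p.2 + 1))) (F * F) :=
    hasSum_mul_self (f := fun a : ℕ => z ^ a * (x : ℂ) ^ (a + 1)) sf (by simpa only [hnf] using sx.summable)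
  have sg : HasSum (fun a : ℕ => z ^ a * (q (a + 1) : ℂ))
      (∑ a ∈ Finset.range n, z ^ a * (q (a + 1) : ℂ)) :=
    hasSum_sum_of_ne_finset_zero fun a ha => by
      rw [Finset.mem_range] at ha
      rw [hq0 (a + 1) (by omega), Complex.ofReal_zero, mul_zero]
  have sg2 : HasSum (fun p : ℕ × ℕ => z ^ (p.1 + p.2) * (q (p.1 + 1 + (p.2 + 1)) : ℂ))
      (∑ p ∈ Finset.range n ×ˢ Finset.range n, z ^ (p.1 + p.2) * (q (p.1 + 1 + (p.2 + 1)) : ℂ)) :=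
    hasSum_sum_of_ne_finset_zero fun p hp => by
      simp only [Finset.mem_product, Finset.mem_range] at hp
      rw [hq0 (p.1 + 1 + (p.2 + 1)) (by omega), Complex.ofReal_zero, mul_zero]
  constructor
  · rw [norm_sub_rev, ← (sf.sub sg).tsum_eq]
    refine tsum_of_norm_bounded (sx.sub sq1) fun a => ?_
    rw [← mul_sub, norm_mul, norm_pow, hz, one_pow, one_mul, ← Complex.ofReal_pow,
      ← Complex.ofReal_sub, Complex.norm_real, Real.norm_of_nonneg (sub_nonneg.2 (hqx _))]
  · rw [← Finset.sum_product', ← Finset.sum_product', sq F, sq, norm_sub_rev,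
      ← (sf2.sub sg2).tsum_eq]
    refine tsum_of_norm_bounded (sx2.sub sq2) fun p => ?_
    have : (z ^ p.1 * (x : ℂ) ^ (p.1 + 1)) * (z ^ p.2 * (x : ℂ) ^ (p.2 + 1)) -
        z ^ (p.1 + p.2) * (q (p.1 + 1 + (p.2 + 1)) : ℂ) = z ^ (p.1 + p.2) *
          ((x ^ (p.1 + 1) * x ^ (p.2 + 1) - q (p.1 + 1 + (p.2 + 1)) : ℝ) : ℂ) := by
      push_cast; ring
    rw [this, norm_mul, norm_pow, hz, one_pow, one_mul, Complex.norm_real, Real.norm_of_nonneg]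
    rw [← pow_add]
    exact sub_nonneg.2 (hqx _)

theorem sum_choose_sub_div {n m : ℕ} (hm : 0 < m) (hmn : m ≤ n) :
    ∑ a ∈ Finset.range n, ((n - (a + 1)).choose m : ℝ) / n.choose m =
      ((n : ℝ) - m) / (m + 1) := by
  have hN : (n.choose m : ℝ) ≠ 0 := Nat.cast_ne_zero.2 (Nat.choose_pos hmn).ne'
  have c1 : (n.choose (m + 1) : ℝ) * (m + 1) = n.choose m * (n - m) := by
    have := congrArg (Nat.cast : ℕ → ℝ) (Nat.choose_succ_right_eq n m)
    push_cast [Nat.cast_sub hmn] at this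
    exact this
  rw [← Finset.sum_div, ← Nat.cast_sum, sum_range_choose_sub hm le_rfl,
    div_eq_div_iff hN (by positivity)]
  linarith

/-- As a double sum of joint tails, this is the mean of the product of the two gaps. -/
theorem sum_sum_choose_sub_div {n m : ℕ} (hm : 0 < m) (hmn : m ≤ n) :
    ∑ a ∈ Finset.range n, ∑ b ∈ Finset.range n,
      ((n - (a + 1 + (b + 1))).choose m : ℝ) / n.choose m =
      ((n : ℝ) - m) * (n - m - 1) / ((m + 1) * (m + 2)) := by
  have hN : (n.choose m : ℝ) ≠ 0 := Nat.cast_ne_zero.2 (Nat.choose_pos hmn).ne'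
  have c1 : (n.choose (m + 1) : ℝ) * (m + 1) = n.choose m * (n - m) := by
    have := congrArg (Nat.cast : ℕ → ℝ) (Nat.choose_succ_right_eq n m)
    push_cast [Nat.cast_sub hmn] at this
    exact this
  have c2 : (n.choose (m + 2) : ℝ) * (m + 2) = n.choose (m + 1) * (n - m - 1) := by
    rcases hmn.eq_or_lt with h | h
    · rw [h, Nat.choose_eq_zero_of_lt (by omega), Nat.choose_eq_zero_of_lt (by omega)]; simp
    have := congrArg (Nat.cast : ℕ → ℝ) (Nat.choose_succ_right_eq n (m + 1))
    push_cast [Nat.cast_sub h] at this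
    linarith
  have : ∀ a ∈ Finset.range n, ∑ b ∈ Finset.range n,
      ((n - (a + 1 + (b + 1))).choose m : ℝ) / n.choose m =
        ((n - (a + 1)).choose (m + 1) : ℝ) / n.choose m := by
    intro a _
    rw [← Finset.sum_div, ← Nat.cast_sum]
    simp only [Nat.sub_add_eq _ (_ + 1) (_ + 1)]
    rw [sum_range_choose_sub hm (by omega)]
  rw [Finset.sum_congr rfl this, ← Finset.sum_div, ← Nat.cast_sum,
    sum_range_choose_sub (by omega) le_rfl, div_eq_div_iff hN (by positivity)]
  linear_combination ((m : ℝ) + 1) * c2 + ((n : ℝ) - m - 1) * c1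

/-- The sum of the two extreme gaps of a uniform `m`-subset of `Fin n` is close to a sum of two
independent geometric variables of mean `r = (n - m) / m`. -/
theorem norm_sum_pow_gap_sub_le {n m : ℕ} (hm : 0 < m) (hmn : m ≤ n) {z : ℂ} (hz : ‖z‖ = 1) {r : ℝ}
    (hr : r = ((n : ℝ) - m) / m) :
    ‖(∑ S ∈ Finset.powersetCard m (Finset.univ : Finset (Fin n)), z ^ (lowGap S + highGap S)) /
        n.choose m - ((1 - r * (z - 1))⁻¹) ^ 2‖ ≤
      2 * ‖z - 1‖ * (r / m) + ‖z - 1‖ ^ 2 * ((3 * r ^ 2 + r) / m) := by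
  have hm0 : (0 : ℝ) < m := Nat.cast_pos.2 hm
  have hn0 : (0 : ℝ) < n := Nat.cast_pos.2 (hm.trans_le hmn)
  have hmn' : (m : ℝ) ≤ n := Nat.cast_le.2 hmn
  have hN : (0 : ℝ) < n.choose m := Nat.cast_pos.2 (Nat.choose_pos hmn)
  obtain ⟨x, hx⟩ : ∃ x : ℝ, x = ((n : ℝ) - m) / n := ⟨_, rfl⟩
  have hx0 : 0 ≤ x := hx ▸ div_nonneg (sub_nonneg.2 hmn') hn0.le
  have hx1 : x < 1 := by rw [hx, div_lt_one hn0]; linarith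
  obtain ⟨q, hq⟩ : ∃ q : ℕ → ℝ, ∀ g, q g = ((n - g).choose m : ℝ) / n.choose m :=
    ⟨_, fun _ => rfl⟩
  have hqx : ∀ g, q g ≤ x ^ g := fun g => by
    rw [hq, div_le_iff₀ hN, mul_comm, hx]; exact choose_sub_le hm hmn g
  have hq0 : ∀ g, n ≤ g → q g = 0 := fun g hg => by
    rw [hq, Nat.sub_eq_zero_of_le hg, Nat.choose_eq_zero_of_lt hm, Nat.cast_zero, zero_div]
  have hxr : x / (1 - x) = r := by
    have h1x : 1 - x = m / n := by rw [hx]; field_simp; ring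
    rw [h1x, hr, hx]; field_simp
  obtain ⟨d1, d2⟩ := norm_sum_sub_geometric_le hx0 hx1 hqx hq0 hz
  have t1 : ∑ a ∈ Finset.range n, q (a + 1) = (n - m) / (m + 1) := by
    simp only [hq]; exact sum_choose_sub_div hm hmn
  have t2 : ∑ a ∈ Finset.range n, ∑ b ∈ Finset.range n, q (a + 1 + (b + 1)) =
      (n - m) * (n - m - 1) / ((m + 1) * (m + 2)) := by
    simp only [hq]; exact sum_sum_choose_sub_div hm hmn
  rw [hxr, t1] at d1
  rw [hxr, t2] at d2
  obtain ⟨F, hF⟩ : ∃ F : ℂ, F = x * (1 - x * z)⁻¹ := ⟨_, rfl⟩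
  rw [← hF] at d1 d2
  -- The left side is the generating function of a geometric variable of mean `r`, equal to `(1 - x)
  -- / (1 - x * z)`. The square of `1 + (z - 1) * F` then matches the expansion in `sum_pow_gap`
  -- term by term.
  have htarget : (1 - r * (z - 1))⁻¹ = 1 + (z - 1) * F := by
    have h1 : 1 - x * z ≠ 0 := by
      intro h
      rw [sub_eq_zero] at h
      have := congrArg norm h
      rw [norm_one, norm_mul, hz, mul_one, Complex.norm_real, Real.norm_of_nonneg hx0] at this
      exact hx1.ne' this
    have h2 : (1 - r * (z - 1)) * (1 - x) = (1 - x * z : ℂ) := by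
      have h3 : r * (1 - x) = x := by
        rw [← hxr, div_mul_cancel₀]; linarith
      have h4 : (r : ℂ) * (1 - x) = x := by exact_mod_cast h3
      linear_combination (1 - z) * h4
    refine inv_eq_of_mul_eq_one_right ?_
    have h6 : 1 + (z - 1) * F = (1 - x) * (1 - x * z)⁻¹ := by
      rw [hF]
      linear_combination -mul_inv_cancel₀ h1
    rw [h6, ← mul_assoc, h2, mul_inv_cancel₀ h1]
  have hNc : (n.choose m : ℂ) ≠ 0 := by exact_mod_cast hN.ne'
  have g1 : ∑ a ∈ Finset.range n, z ^ a * (q (a + 1) : ℂ) =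
      (∑ a ∈ Finset.range n, z ^ a * ((n - (a + 1)).choose m : ℂ)) / n.choose m := by
    rw [Finset.sum_div]
    refine Finset.sum_congr rfl fun a _ => ?_
    rw [hq]; push_cast; ring
  have g2 : ∑ a ∈ Finset.range n, ∑ b ∈ Finset.range n, z ^ (a + b) * (q (a + 1 + (b + 1)) : ℂ) =
      (∑ a ∈ Finset.range n, ∑ b ∈ Finset.range n,
        z ^ (a + b) * ((n - (a + 1) - (b + 1)).choose m : ℂ)) / n.choose m := by
    rw [Finset.sum_div]
    refine Finset.sum_congr rfl fun a _ => ?_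
    rw [Finset.sum_div]
    refine Finset.sum_congr rfl fun b _ => ?_
    rw [hq, Nat.sub_add_eq _ (_ + 1) (_ + 1)]; push_cast; ring
  have hmain : (∑ S ∈ Finset.powersetCard m (Finset.univ : Finset (Fin n)),
      z ^ (lowGap S + highGap S)) / n.choose m - ((1 - r * (z - 1))⁻¹) ^ 2 =
      2 * (z - 1) * (∑ a ∈ Finset.range n, z ^ a * (q (a + 1) : ℂ) - F) +
      (z - 1) ^ 2 * (∑ a ∈ Finset.range n, ∑ b ∈ Finset.range n,
        z ^ (a + b) * (q (a + 1 + (b + 1)) : ℂ) - F ^ 2) := by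
    rw [htarget, sum_pow_gap n m hm, g1, g2, add_div, add_div, div_self hNc]
    ring
  have hr0 : 0 ≤ r := by rw [hr]; exact div_nonneg (by linarith) hm0.le
  have hnm : (n : ℝ) - m = r * m := by rw [hr, div_mul_cancel₀ _ hm0.ne']
  have b1 : r - (n - m) / (m + 1) ≤ r / m := by
    rw [hnm, sub_le_iff_le_add, ← sub_nonneg]
    have : r / m + r * m / (m + 1) - r = r / (m * (m + 1)) := by field_simp; ring
    rw [this]; positivity
  have b2 : r ^ 2 - (n - m) * (n - m - 1) / ((m + 1) * (m + 2)) ≤ (3 * r ^ 2 + r) / m := by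
    rw [hnm, sub_le_iff_le_add, ← sub_nonneg]
    have : (3 * r ^ 2 + r) / m + r * m * (r * m - 1) / ((m + 1) * (m + 2)) - r ^ 2 =
        (r ^ 2 * (7 * m + 6) + r * (3 * m + 2)) / (m * ((m + 1) * (m + 2))) := by
      field_simp; ring
    rw [this]; positivity
  rw [hmain]
  refine (norm_add_le _ _).trans (add_le_add ?_ ?_)
  · rw [norm_mul, norm_mul, Complex.norm_ofNat]
    exact mul_le_mul_of_nonneg_left (d1.trans b1) (by positivity)
  · rw [norm_mul, norm_pow]
    exact mul_le_mul_of_nonneg_left (d2.trans b2) (by positivity)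

/-! ### Averaging over the support of a cyclic permutation -/

theorem card_support_eq_numNonFixed {n : ℕ} {t : n.Partition} {σ : Equiv.Perm (Fin n)}
    (hσ : σ ∈ cyclicPerms t) : σ.support.card = numNonFixed t := by
  have h : σ.partition.parts = t.parts := hσ
  rw [numNonFixed, numFixed, ← h, Equiv.Perm.parts_partition, Multiset.count_add,
    Multiset.count_eq_zero_of_notMem fun h1 => by
      have := Equiv.Perm.two_le_of_mem_cycleType h1
      omega]
  have := Finset.card_le_univ σ.support
  simp only [Fintype.card_fin, Multiset.count_replicate_self] at this ⊢
  omega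

theorem conj_mem_cyclicPerms {n : ℕ} {t : n.Partition} {σ : Equiv.Perm (Fin n)}
    (hσ : σ ∈ cyclicPerms t) (π : Equiv.Perm (Fin n)) : π * σ * π⁻¹ ∈ cyclicPerms t := by
  have h : σ.partition = (π * σ * π⁻¹).partition :=
    Equiv.Perm.partition_eq_of_isConj.1 (isConj_iff.2 ⟨π, rfl⟩)
  change (π * σ * π⁻¹).partition.parts = t.parts
  rw [← congrArg Nat.Partition.parts h]
  exact hσ

theorem support_conj_eq_image {α : Type*} [DecidableEq α] [Fintype α] (π σ : Equiv.Perm α) :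
    (π * σ * π⁻¹).support = σ.support.image π := by
  rw [Equiv.Perm.support_conj, Finset.map_eq_image]
  rfl

theorem image_eq_of_support_subset {α : Type*} [DecidableEq α] [Fintype α] {π : Equiv.Perm α}
    {S : Finset α} (h : π.support ⊆ S) : S.image π = S := by
  refine Finset.eq_of_subset_of_card_le (fun x hx => ?_)
    (Finset.card_image_of_injective _ π.injective).ge
  obtain ⟨y, hy, rfl⟩ := Finset.mem_image.1 hx
  by_cases hyπ : y ∈ π.support
  · exact h (Equiv.Perm.apply_mem_support.2 hyπ)
  · rwa [Equiv.Perm.notMem_support.1 hyπ]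

theorem exists_perm_image_eq {α : Type*} [DecidableEq α] [Fintype α] {S T : Finset α}
    (h : S.card = T.card) : ∃ π : Equiv.Perm α, S.image π = T := by
  let e : {x // x ∈ S} ≃ {x // x ∈ T} := Finset.equivOfCardEq h
  refine ⟨e.extendSubtype, Finset.eq_of_subset_of_card_le (fun x hx => ?_) ?_⟩
  · obtain ⟨y, hy, rfl⟩ := Finset.mem_image.1 hx
    exact e.extendSubtype_mem y hy
  · rw [Finset.card_image_of_injective _ (Equiv.injective _), h]

section Cyclic

variable {n : ℕ} {t : n.Partition} {C : Finset (Equiv.Perm (Fin n))}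

theorem isConjStable_filter_support (hC : ∀ σ, σ ∈ C ↔ σ ∈ cyclicPerms t) (S : Finset (Fin n)) :
    IsConjStable (C.filter fun σ => σ.support = S) S where
  conj_mem σ hσ π hπ := by
    rw [Finset.mem_filter] at hσ ⊢
    refine ⟨(hC _).2 (conj_mem_cyclicPerms ((hC _).1 hσ.1) π), ?_⟩
    rw [support_conj_eq_image, hσ.2, image_eq_of_support_subset hπ]
  support_eq σ hσ := (Finset.mem_filter.1 hσ).2

/-- Conjugation by a permutation carrying `S` onto `T` injects one fibre into the other. Used in
both directions, it shows that the support of a uniform cyclic permutation is a uniform subset. -/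
theorem card_filter_support_le (hC : ∀ σ, σ ∈ C ↔ σ ∈ cyclicPerms t) {S T : Finset (Fin n)}
    (h : S.card = T.card) : (C.filter fun σ => σ.support = S).card ≤
      (C.filter fun σ => σ.support = T).card := by
  obtain ⟨π, hπ⟩ := exists_perm_image_eq h
  refine Finset.card_le_card_of_injOn (fun σ => π * σ * π⁻¹) (fun σ hσ => ?_) (fun σ _ τ _ e => ?_)
  · simp only [Finset.coe_filter, Set.mem_ofPred_eq] at hσ ⊢
    refine ⟨(hC _).2 (conj_mem_cyclicPerms ((hC _).1 hσ.1) π), ?_⟩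
    rw [support_conj_eq_image, hσ.2, hπ]
  · simpa using e

/-- The characteristic function of the centred number of records of a uniform `t`-cyclic
permutation. -/
theorem norm_sum_exp_hrec_sub_le (hC : ∀ σ, σ ∈ C ↔ σ ∈ cyclicPerms t) (hne : C.Nonempty) {L : ℕ}
    (hL : 0 < L) (hLm : 2 * L ≤ numNonFixed t) (hm : 8 ≤ numNonFixed t) {u : ℝ} (hu : |u| ≤ 1)
    {r : ℝ} (hr : r = ((n : ℝ) - numNonFixed t) / numNonFixed t) :
    ‖(∑ σ ∈ C, Complex.exp ((u * ((hrec σ : ℝ) - Real.log (numNonFixed t)) : ℝ) * Complex.I)) /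
        C.card - ((1 - r * (Complex.exp (u * Complex.I) - 1))⁻¹) ^ 2 *
          Real.exp (-(u ^ 2 * Real.log (numNonFixed t)) / 2)‖ ≤
      recordError (numNonFixed t) L u +
        (2 * |u| * (r / numNonFixed t) + u ^ 2 * ((3 * r ^ 2 + r) / numNonFixed t)) := by
  set m := numNonFixed t with hmdef
  have hmn : m ≤ n := Nat.sub_le _ _
  set z := Complex.exp (u * Complex.I) with hz
  have hzn : ‖z‖ = 1 := Complex.norm_exp_ofReal_mul_I u
  have hz1 : ‖z - 1‖ ≤ |u| := by
    have := Real.norm_exp_I_mul_ofReal_sub_one_le (x := u)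
    rw [mul_comm] at this
    simpa using this
  set g : ℝ := Real.exp (-(u ^ 2 * Real.log m) / 2) with hg
  set P := Finset.powersetCard m (Finset.univ : Finset (Fin n)) with hP
  have hmaps : ∀ σ ∈ C, σ.support ∈ P := fun σ hσ =>
    Finset.mem_powersetCard.2 ⟨Finset.subset_univ _, card_support_eq_numNonFixed ((hC σ).1 hσ)⟩
  obtain ⟨σ₀, hσ₀⟩ := hne
  set K := (C.filter fun σ => σ.support = σ₀.support).card with hK
  have hcard : ∀ S ∈ P, (C.filter fun σ => σ.support = S).card = K := fun S hS => by
    have : S.card = σ₀.support.card := by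
      rw [(Finset.mem_powersetCard.1 hS).2, (Finset.mem_powersetCard.1 (hmaps _ hσ₀)).2]
    exact le_antisymm (card_filter_support_le hC this) (card_filter_support_le hC this.symm)
  have hCK : C.card = n.choose m * K := by
    rw [Finset.card_eq_sum_card_fiberwise hmaps, Finset.sum_congr rfl hcard, Finset.sum_const,
      Finset.card_powersetCard, Finset.card_univ, Fintype.card_fin, smul_eq_mul]
  have hC0 : 0 < C.card := Finset.card_pos.2 ⟨σ₀, hσ₀⟩
  have hCr : (0 : ℝ) < C.card := Nat.cast_pos.2 hC0
  have hK0 : (K : ℂ) ≠ 0 := by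
    rintro h
    rw [Nat.cast_eq_zero] at h
    rw [hCK, h, mul_zero] at hC0
    exact lt_irrefl _ hC0
  -- The error bound does not depend on `S`, and `S` enters the approximation only through its gaps;
  -- this decouples the Gaussian factor from the gap factor.
  have hfib : ∀ S ∈ P, ‖∑ σ ∈ C.filter (fun σ => σ.support = S),
      Complex.exp ((u * ((hrec σ : ℝ) - Real.log m) : ℝ) * Complex.I) -
        z ^ (lowGap S + highGap S) * (K * g)‖ ≤ recordError m L u * K := by
    intro S hS
    have hSm : S.card = m := (Finset.mem_powersetCard.1 hS).2
    have := (isConjStable_filter_support hC S).norm_sum_exp_recOn_sub_le hL (by rwa [hSm])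
      (by rwa [hSm]) hu
    rw [hSm, hcard S hS, ← hg] at this
    have h1 : ∀ σ : Equiv.Perm (Fin n),
        Complex.exp ((u * ((hrec σ : ℝ) - Real.log m) : ℝ) * Complex.I) =
          z ^ (lowGap S + highGap S) * Complex.exp ((u * ((recOn σ Finset.univ : ℝ) -
            (lowGap S + highGap S : ℕ) - Real.log m) : ℝ) * Complex.I) := fun σ => by
      rw [recOn_univ_eq_hrec, hz, ← Complex.exp_nat_mul, ← Complex.exp_add]
      congr 1
      push_cast
      ring
    rw [Finset.sum_congr rfl fun σ _ => h1 σ, ← Finset.mul_sum, ← mul_sub, norm_mul, norm_pow,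
      hzn, one_pow, one_mul]
    exact this
  have hsum : ‖∑ σ ∈ C, Complex.exp ((u * ((hrec σ : ℝ) - Real.log m) : ℝ) * Complex.I) -
      (∑ S ∈ P, z ^ (lowGap S + highGap S)) * (K * g)‖ ≤ recordError m L u * C.card := by
    rw [← Finset.sum_fiberwise_of_maps_to hmaps, Finset.sum_mul, ← Finset.sum_sub_distrib]
    refine (norm_sum_le_of_le _ hfib).trans (le_of_eq ?_)
    rw [Finset.sum_const, Finset.card_powersetCard, Finset.card_univ, Fintype.card_fin, hCK,
      nsmul_eq_mul]
    push_cast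
    ring
  have hgap := norm_sum_pow_gap_sub_le (by omega : 0 < m) hmn hzn hr
  have hg1 : ‖(g : ℂ)‖ ≤ 1 := by
    rw [Complex.norm_real, Real.norm_eq_abs, Real.abs_exp, Real.exp_le_one_iff]
    have : 0 ≤ u ^ 2 * Real.log m := mul_nonneg (sq_nonneg _) (Real.log_natCast_nonneg _)
    linarith
  have e1 : ‖(∑ σ ∈ C, Complex.exp ((u * ((hrec σ : ℝ) - Real.log m) : ℝ) * Complex.I)) / C.card -
      (∑ S ∈ P, z ^ (lowGap S + highGap S)) / n.choose m * g‖ ≤ recordError m L u := by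
    have : (∑ S ∈ P, z ^ (lowGap S + highGap S)) / n.choose m * g =
        (∑ S ∈ P, z ^ (lowGap S + highGap S)) * (K * g) / C.card := by
      rw [hCK]; push_cast; field_simp
    rw [this, ← sub_div, norm_div, Complex.norm_natCast, div_le_iff₀ hCr]
    exact hsum
  have e2 : ‖(∑ S ∈ P, z ^ (lowGap S + highGap S)) / n.choose m * g -
      ((1 - r * (z - 1))⁻¹) ^ 2 * g‖ ≤
      2 * |u| * (r / m) + u ^ 2 * ((3 * r ^ 2 + r) / m) := by
    have hr0 : 0 ≤ r := by
      rw [hr]; exact div_nonneg (sub_nonneg.2 (Nat.cast_le.2 hmn)) (Nat.cast_nonneg _)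
    rw [← sub_mul, norm_mul]
    refine (mul_le_of_le_one_right (norm_nonneg _) hg1).trans (hgap.trans ?_)
    rw [← sq_abs u]
    gcongr
  exact (norm_sub_le_norm_sub_add_norm_sub _ _ _).trans (add_le_add e1 e2)

end Cyclic

/-! ### Characteristic functions of the uniform and Gamma laws -/

theorem integral_uniformOn_finset {Ω : Type*} [Fintype Ω] [MeasurableSpace Ω]
    [MeasurableSingletonClass Ω] (C : Finset Ω) (f : Ω → ℂ) :
    ∫ ω, f ω ∂(uniformOn (C : Set Ω)) = (∑ ω ∈ C, f ω) / C.card := by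
  classical
  have : IsFiniteMeasure (uniformOn (C : Set Ω)) := by
    rcases C.eq_empty_or_nonempty with rfl | h
    · rw [Finset.coe_empty, uniformOn_empty_meas]; infer_instance
    · have := isProbabilityMeasure_uniformOn C.finite_toSet h
      infer_instance
  rw [integral_fintype Integrable.of_finite, Finset.sum_div, ← Finset.sum_subset C.subset_univ]
  · refine Finset.sum_congr rfl fun ω hω => ?_
    rw [measureReal_def, ← Finset.coe_singleton, uniformOn_apply_finset,
      Finset.inter_singleton_of_mem hω, Finset.card_singleton, ENNReal.toReal_div]
    simp [div_eq_inv_mul]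
  · intro ω _ hω
    rw [measureReal_def, ← Finset.coe_singleton, uniformOn_apply_finset,
      Finset.inter_singleton_of_notMem hω]
    simp

theorem charFun_gammaMeasure_two_one (s : ℝ) :
    charFun (gammaMeasure 2 1) s = ((1 - s * Complex.I)⁻¹) ^ 2 := by
  set c : ℂ := 1 - s * Complex.I with hc
  have hcre : c.re = 1 := by simp [hc]
  have hc0 : c ≠ 0 := fun h => by rw [h] at hcre; simp at hcre
  have h1 : charFun (gammaMeasure 2 1) s =
      ∫ x in Set.Ioi (0 : ℝ), (x : ℂ) * Complex.exp (-c * x) := by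
    have hpdf : Measurable (gammaPDF 2 1) := (measurable_gammaPDFReal 2 1).ennreal_ofReal
    rw [charFun_apply_real, gammaMeasure, integral_withDensity_eq_integral_toReal_smul hpdf
        (Filter.Eventually.of_forall fun _ => ENNReal.ofReal_lt_top),
      ← integral_indicator measurableSet_Ioi]
    refine integral_congr_ae (Filter.Eventually.of_forall fun x => ?_)
    simp only
    rcases lt_or_ge 0 x with hx | hx
    · rw [Set.indicator_of_mem (Set.mem_Ioi.2 hx), gammaPDF, gammaPDFReal, if_pos hx.le,
        ENNReal.toReal_ofReal (by positivity)]
      have : Real.Gamma 2 = 1 := Real.Gamma_two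
      rw [this]
      norm_num
      rw [mul_assoc, ← Complex.exp_add, hc]
      congr 2
      ring
    · rw [Set.indicator_of_notMem (by simpa using hx)]
      rcases hx.eq_or_lt with rfl | hx
      · norm_num [gammaPDF, gammaPDFReal]
      · simp [gammaPDF_of_neg hx]
  -- An explicit antiderivative of `x * exp (-c * x)`; it vanishes at infinity since `c` has real
  -- part `1`, and its value at `0` gives `1 / c ^ 2`.
  have hderiv : ∀ x ∈ Set.Ici (0 : ℝ), HasDerivAt
      (fun x : ℝ => -(x / c + 1 / c ^ 2) * Complex.exp (-c * x)) (x * Complex.exp (-c * x)) x := by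
    intro x _
    have e1 : HasDerivAt (fun x : ℝ => (x : ℂ)) 1 x := Complex.ofRealCLM.hasDerivAt
    have e2 := (((e1.div_const c).add_const (1 / c ^ 2)).neg).mul ((e1.const_mul (-c)).cexp)
    convert! e2 using 1
    simp only [Pi.neg_apply]
    field_simp
    ring
  have hnorm : ∀ x : ℝ, ‖Complex.exp (-c * x)‖ = Real.exp (-x) := fun x => by
    rw [Complex.norm_exp]
    congr 1
    rw [Complex.re_mul_ofReal, Complex.neg_re, hcre]
    ring
  have hint : IntegrableOn (fun x : ℝ => (x : ℂ) * Complex.exp (-c * x)) (Set.Ioi 0) := by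
    have hg := Real.GammaIntegral_convergent (s := 2) (by norm_num)
    refine hg.mono' (by fun_prop) ?_
    refine (ae_restrict_iff' measurableSet_Ioi).2 (Filter.Eventually.of_forall fun x hx => ?_)
    rw [norm_mul, hnorm, Complex.norm_real, Real.norm_of_nonneg (le_of_lt hx)]
    norm_num
    rw [mul_comm]
  have hlim : Tendsto (fun x : ℝ => -(x / c + 1 / c ^ 2) * Complex.exp (-c * x)) atTop (𝓝 0) := by
    rw [tendsto_zero_iff_norm_tendsto_zero]
    have hb : Tendsto (fun x : ℝ => ‖c‖⁻¹ * (x ^ 1 * Real.exp (-x)) +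
        ‖1 / c ^ 2‖ * (x ^ 0 * Real.exp (-x))) atTop (𝓝 (‖c‖⁻¹ * 0 + ‖1 / c ^ 2‖ * 0)) :=
      ((Real.tendsto_pow_mul_exp_neg_atTop_nhds_zero 1).const_mul _).add
        ((Real.tendsto_pow_mul_exp_neg_atTop_nhds_zero 0).const_mul _)
    rw [mul_zero, mul_zero, add_zero] at hb
    refine squeeze_zero' (Filter.Eventually.of_forall fun _ => norm_nonneg _) ?_ hb
    filter_upwards [eventually_ge_atTop 0] with x hx
    rw [norm_mul, hnorm, norm_neg, pow_one, pow_zero, one_mul]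
    have : ‖(x : ℂ) / c + 1 / c ^ 2‖ ≤ ‖c‖⁻¹ * x + ‖1 / c ^ 2‖ := by
      refine (norm_add_le _ _).trans (le_of_eq ?_)
      rw [norm_div, Complex.norm_real, Real.norm_of_nonneg hx]
      ring
    calc _ ≤ (‖c‖⁻¹ * x + ‖1 / c ^ 2‖) * Real.exp (-x) := by gcongr
      _ = _ := by ring
  rw [h1, integral_Ioi_of_hasDerivAt_of_tendsto' hderiv hint hlim]
  simp

/-! ### Passage to the limit -/

/-- The factor `r` may be unbounded, but the quadratic remainder of the exponential contributes at
most `|r * u| * |u|`, which tends to `0`. -/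
theorem tendsto_mul_cexp_sub_one {r u : ℕ → ℝ} {v : ℝ} (hu : Tendsto u atTop (𝓝 0))
    (hru : Tendsto (fun n => r n * u n) atTop (𝓝 v)) :
    Tendsto (fun n => (r n : ℂ) * (Complex.exp (u n * Complex.I) - 1)) atTop
      (𝓝 (v * Complex.I)) := by
  have h1 : Tendsto (fun n => ((r n * u n : ℝ) : ℂ) * Complex.I) atTop (𝓝 (v * Complex.I)) :=
    ((Complex.continuous_ofReal.tendsto v).comp hru).mul_const _
  have h2 : Tendsto (fun n => (r n : ℂ) * (Complex.exp (u n * Complex.I) - 1 - u n * Complex.I))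
      atTop (𝓝 0) := by
    rw [tendsto_zero_iff_norm_tendsto_zero]
    have hb : Tendsto (fun n => |r n * u n| * |u n|) atTop (𝓝 (|v| * |0|)) := hru.abs.mul hu.abs
    rw [abs_zero, mul_zero] at hb
    refine squeeze_zero' (Filter.Eventually.of_forall fun _ => norm_nonneg _) ?_ hb
    have hu1 : ∀ᶠ n in atTop, |u n| < 1 := by
      have := hu.abs
      rw [abs_zero] at this
      exact this.eventually_lt_const one_pos
    filter_upwards [hu1] with n hn
    have hI : ‖(u n * Complex.I : ℂ)‖ = |u n| := by simp
    have := Complex.norm_exp_sub_one_sub_id_le (x := u n * Complex.I) (by rw [hI]; exact hn.le)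
    rw [hI] at this
    rw [norm_mul, Complex.norm_real, Real.norm_eq_abs, abs_mul, mul_assoc, ← sq]
    gcongr
  have h3 := h1.add h2
  rw [add_zero] at h3
  refine h3.congr fun n => ?_
  push_cast
  ring

/-- With `L` fixed, every term vanishes except `2 * (16 / L)`, the chance that too few elements
cross from or into the extreme segments. -/
theorem tendsto_recordError {m : ℕ → ℕ} {u : ℕ → ℝ} {κ : ℝ} (hm : Tendsto m atTop atTop)
    (hu : Tendsto u atTop (𝓝 0))
    (hκ : Tendsto (fun n => u n ^ 2 * Real.log (m n)) atTop (𝓝 κ)) (L : ℕ) :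
    Tendsto (fun n => recordError (m n) L (u n)) atTop (𝓝 (32 / L)) := by
  have hm' : Tendsto (fun n => (m n : ℝ)) atTop atTop := tendsto_natCast_atTop_atTop.comp hm
  have ha : Tendsto (fun n => |u n|) atTop (𝓝 0) := by simpa using hu.abs
  have hi : ∀ a : ℝ, Tendsto (fun n => a / (m n : ℝ)) atTop (𝓝 0) := fun a =>
    hm'.const_div_atTop a
  have hi' : Tendsto (fun n => 2 * (L : ℝ) / ((m n : ℝ) - 1)) atTop (𝓝 0) :=
    (tendsto_atTop_add_const_right _ (-1) hm').const_div_atTop _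
  have h3 : Tendsto (fun n => |u n| ^ 3 * (1 + Real.log (m n))) atTop (𝓝 0) := by
    have := (ha.pow 3).add (ha.mul hκ)
    simp only [ne_eq, OfNat.ofNat_ne_zero, not_false_eq_true, zero_pow, zero_mul, add_zero] at this
    refine this.congr fun n => ?_
    rw [← sq_abs (u n)]; ring
  have := (((((hu.pow 2).const_mul 2).add h3).add ((ha.add (hu.pow 2)).const_mul 3)).add
    ((hi 40).const_mul 2)).add ((ha.mul_const (2 * (L : ℝ))).add
      (((tendsto_const_nhds (x := 16 / (L : ℝ))).add (hi 48) |>.add hi').const_mul 2))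
  unfold recordError
  convert this using 2
  ring

theorem exists_finset_cyclicPerms {n : ℕ} (t : n.Partition) :
    ∃ C : Finset (Equiv.Perm (Fin n)), (C : Set (Equiv.Perm (Fin n))) = cyclicPerms t :=
  (Set.toFinite (cyclicPerms t)).exists_finset_coe

instance permFinMeasurableSingletonClass (n : ℕ) :
    MeasurableSingletonClass (Equiv.Perm (Fin n)) := ⟨fun _ => trivial⟩

theorem charFun_map_comp_of_hasLaw {n : ℕ} {t : n.Partition} {Ω : Type*} [MeasurableSpace Ω]
    {P : Measure Ω} {τ : Ω → Equiv.Perm (Fin n)} (hτ : HasLaw τ (uniformOn (cyclicPerms t)) P)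
    {C : Finset (Equiv.Perm (Fin n))} (hC : (C : Set (Equiv.Perm (Fin n))) = cyclicPerms t)
    (f : Equiv.Perm (Fin n) → ℝ) (s : ℝ) :
    charFun (P.map fun ω => f (τ ω)) s =
      (∑ σ ∈ C, Complex.exp ((s * f σ : ℝ) * Complex.I)) / C.card := by
  have hf : Measurable f := fun _ _ => trivial
  have h1 : P.map (fun ω => f (τ ω)) = (uniformOn (cyclicPerms t)).map f := by
    rw [← hτ.map_eq, AEMeasurable.map_map_of_aemeasurable hf.aemeasurable hτ.aemeasurable]
    rfl
  rw [h1, ← hC, charFun_apply_real, integral_map hf.aemeasurable (by fun_prop),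
    integral_uniformOn_finset]
  push_cast
  rfl

theorem nonempty_of_hasLaw {n : ℕ} {t : n.Partition} {Ω : Type*} [MeasurableSpace Ω]
    {P : Measure Ω} [IsProbabilityMeasure P] {τ : Ω → Equiv.Perm (Fin n)}
    (hτ : HasLaw τ (uniformOn (cyclicPerms t)) P)
    {C : Finset (Equiv.Perm (Fin n))} (hC : (C : Set (Equiv.Perm (Fin n))) = cyclicPerms t) :
    C.Nonempty := by
  rw [Finset.nonempty_iff_ne_empty]
  rintro rfl
  have h1 : IsProbabilityMeasure (uniformOn (cyclicPerms t)) := by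
    rw [← hτ.map_eq]; exact Measure.isProbabilityMeasure_map hτ.aemeasurable
  rw [← hC, Finset.coe_empty, uniformOn_empty_meas] at h1
  exact zero_ne_one h1.measure_univ

/-- The number of records converges in distribution under an arbitrary normalisation of the right
order. -/
theorem tendstoInDistribution_hrec
    (t : (n : ℕ) → n.Partition)
    {Ω : ℕ → Type*} [∀ n, MeasurableSpace (Ω n)]
    (P : (n : ℕ) → Measure (Ω n)) [∀ n, IsProbabilityMeasure (P n)]
    (τ : (n : ℕ) → Ω n → Equiv.Perm (Fin n))
    (hτ : ∀ n, HasLaw (τ n) (uniformOn (cyclicPerms (t n))) (P n))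
    {Ω' : Type*} [MeasurableSpace Ω'] (Q : Measure Ω') [IsProbabilityMeasure Q]
    (Y G : Ω' → ℝ)
    (hY : HasLaw Y (gaussianReal 0 1) Q)
    (hG : HasLaw G (gammaMeasure 2 1) Q)
    (hYG : IndepFun Y G Q) (D e : ℕ → ℝ) {c d : ℝ}
    (hm : Tendsto (fun n : ℕ => numNonFixed (t n)) atTop atTop)
    (hD : ∀ᶠ n in atTop, √(Real.log (numNonFixed (t n))) ≤ D n)
    (hc : Tendsto (fun n => √(Real.log (numNonFixed (t n))) / D n) atTop (𝓝 c))
    (hd : Tendsto (fun n : ℕ => ((n : ℝ) - numNonFixed (t n)) / numNonFixed (t n) / D n) atTop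
      (𝓝 d))
    (he : Tendsto (fun n => (Real.log (numNonFixed (t n)) - e n) / D n) atTop (𝓝 0)) :
    TendstoInDistribution (fun (n : ℕ) (ω : Ω n) => ((hrec (τ n ω) : ℝ) - e n) / D n) atTop
      (fun ω' => c * Y ω' + d * G ω') P Q := by
  have hYm := hY.aemeasurable
  have hGm := hG.aemeasurable
  have hmeas : ∀ n, AEMeasurable (fun ω => ((hrec (τ n ω) : ℝ) - e n) / D n) (P n) := fun n =>
    (show Measurable fun σ : Equiv.Perm (Fin n) => ((hrec σ : ℝ) - e n) / D n from
      fun _ _ => trivial).comp_aemeasurable (hτ n).aemeasurable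
  refine ⟨hmeas, by fun_prop, ?_⟩
  refine ProbabilityMeasure.tendsto_iff_tendsto_charFun.2 fun θ => ?_
  change Tendsto (fun n => charFun ((P n).map fun ω => ((hrec (τ n ω) : ℝ) - e n) / D n) θ) atTop
    (𝓝 (charFun (Q.map fun ω' => c * Y ω' + d * G ω') θ))
  set m : ℕ → ℕ := fun n => numNonFixed (t n) with hmdef
  set r : ℕ → ℝ := fun n => ((n : ℝ) - m n) / m n with hrdef
  set u : ℕ → ℝ := fun n => θ / D n with hudef
  have hlim : charFun (Q.map fun ω' => c * Y ω' + d * G ω') θ =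
      ((1 - ((θ * d : ℝ) : ℂ) * Complex.I)⁻¹) ^ 2 * Real.exp (-(θ ^ 2 * c ^ 2) / 2) := by
    have hind : IndepFun (fun ω => c * Y ω) (fun ω => d * G ω) Q :=
      hYG.comp (measurable_const_mul c) (measurable_const_mul d)
    rw [hind.charFun_map_fun_add_eq_mul (by fun_prop) (by fun_prop), Pi.mul_apply,
      charFun_map_mul_comp, charFun_map_mul_comp, hY.map_eq, hG.map_eq, charFun_gaussianReal,
      charFun_gammaMeasure_two_one, mul_comm]
    congr 2
    · push_cast; ring
    · rw [Complex.ofReal_exp]; congr 1; push_cast; ring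
    all_goals fun_prop
  rw [hlim]
  have hm' : Tendsto (fun n => (m n : ℝ)) atTop atTop := tendsto_natCast_atTop_atTop.comp hm
  have hs : Tendsto (fun n => √(Real.log (m n))) atTop atTop :=
    Real.tendsto_sqrt_atTop.comp (Real.tendsto_log_atTop.comp hm')
  -- The lower bound on `D` forces the effective frequency `u = θ / D` to tend to `0`, as all the
  -- estimates require.
  have hDtop : Tendsto D atTop atTop := tendsto_atTop_mono' _ hD hs
  have hu : Tendsto u atTop (𝓝 0) := hDtop.const_div_atTop θ
  have hru : Tendsto (fun n => r n * u n) atTop (𝓝 (θ * d)) :=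
    (hd.const_mul θ).congr fun n => by simp only [hrdef, hudef, hmdef]; ring
  have hκ : Tendsto (fun n => u n ^ 2 * Real.log (m n)) atTop (𝓝 (θ ^ 2 * c ^ 2)) :=
    ((hc.pow 2).const_mul (θ ^ 2)).congr fun n => by
      rw [div_pow, Real.sq_sqrt (Real.log_natCast_nonneg _)]
      simp only [hudef]; ring
  set T : ℕ → ℂ := fun n => ((1 - r n * (Complex.exp (u n * Complex.I) - 1))⁻¹) ^ 2 *
    Real.exp (-(u n ^ 2 * Real.log (m n)) / 2) with hTdef
  have hT : Tendsto T atTop (𝓝 (((1 - ((θ * d : ℝ) : ℂ) * Complex.I)⁻¹) ^ 2 *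
      Real.exp (-(θ ^ 2 * c ^ 2) / 2))) := by
    refine Tendsto.mul (Tendsto.pow (Tendsto.inv₀ ((tendsto_mul_cexp_sub_one hu hru).const_sub 1)
      fun h => ?_) 2) ((Complex.continuous_ofReal.tendsto _).comp
        ((Real.continuous_exp.tendsto _).comp ((hκ.neg).div_const 2)))
    have := congrArg Complex.re h
    simp at this
  choose C hC using fun n => exists_finset_cyclicPerms (t n)
  have hCmem : ∀ n σ, σ ∈ C n ↔ σ ∈ cyclicPerms (t n) := fun n σ => by rw [← hC n]; rfl
  set A : ℕ → ℂ := fun n => (∑ σ ∈ C n, Complex.exp ((u n * ((hrec σ : ℝ) -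
    Real.log (m n)) : ℝ) * Complex.I)) / (C n).card with hAdef
  -- Centring at `e n` instead of `log m` only contributes a phase, which tends to `1`.
  have hchar : ∀ n, charFun ((P n).map fun ω => ((hrec (τ n ω) : ℝ) - e n) / D n) θ =
      A n * Complex.exp ((θ * ((Real.log (m n) - e n) / D n) : ℝ) * Complex.I) := fun n => by
    rw [charFun_map_comp_of_hasLaw (hτ n) (hC n) (fun σ => ((hrec σ : ℝ) - e n) / D n), hAdef,
      div_mul_eq_mul_div, Finset.sum_mul]
    congr 1
    refine Finset.sum_congr rfl fun σ _ => ?_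
    rw [← Complex.exp_add, ← add_mul, ← Complex.ofReal_add]
    congr 3
    simp only [hudef]
    ring
  simp only [hchar]
  have hphase : Tendsto (fun n => Complex.exp ((θ * ((Real.log (m n) - e n) / D n) : ℝ) *
      Complex.I)) atTop (𝓝 1) := by
    have h1 := (Complex.continuous_exp.tendsto _).comp
      (((Complex.continuous_ofReal.tendsto _).comp (he.const_mul θ)).mul_const Complex.I)
    rw [mul_zero, Complex.ofReal_zero, zero_mul, Complex.exp_zero] at h1
    exact h1
  have hA : Tendsto A atTop (𝓝 (((1 - ((θ * d : ℝ) : ℂ) * Complex.I)⁻¹) ^ 2 *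
      Real.exp (-(θ ^ 2 * c ^ 2) / 2))) := by
    suffices h : Tendsto (fun n => A n - T n) atTop (𝓝 0) by
      simpa using h.add hT
    rw [tendsto_zero_iff_norm_tendsto_zero]
    refine Metric.tendsto_nhds.2 fun ε hε => ?_
    -- The length `L` is chosen from `ε` before `n` grows, so that the limiting error `32 / L` is
    -- below `ε`.
    obtain ⟨L, hL⟩ := exists_nat_gt (32 / ε)
    have hL0 : (0 : ℝ) < L := lt_trans (by positivity) hL
    have hLε : 32 / (L : ℝ) < ε := by
      rw [div_lt_iff₀ hε] at hL
      rw [div_lt_iff₀ hL0]; linarith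
    have hi : Tendsto (fun n => 1 / (m n : ℝ)) atTop (𝓝 0) := hm'.const_div_atTop 1
    have hau : Tendsto (fun n => |u n|) atTop (𝓝 0) := by simpa using hu.abs
    have herr : Tendsto (fun n => recordError (m n) L (u n) +
        (2 * |u n| * (r n / m n) + u n ^ 2 * ((3 * r n ^ 2 + r n) / m n))) atTop
        (𝓝 (32 / (L : ℝ))) := by
      have h1 : Tendsto (fun n => 2 * |u n| * (r n / m n)) atTop (𝓝 0) := by
        have h := ((hru.abs.const_mul 2).mul hi)
        rw [mul_zero] at h
        refine h.congr fun n => ?_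
        have hr0 : 0 ≤ r n := div_nonneg
          (sub_nonneg.2 (Nat.cast_le.2 (Nat.sub_le _ _))) (Nat.cast_nonneg _)
        rw [abs_mul, abs_of_nonneg hr0]; ring
      have h2 : Tendsto (fun n => u n ^ 2 * ((3 * r n ^ 2 + r n) / m n)) atTop (𝓝 0) := by
        have h := ((((hru.pow 2).const_mul 3).add (hu.mul hru)).mul hi)
        rw [mul_zero] at h
        exact h.congr fun n => by ring
      have := (tendsto_recordError hm hu hκ L).add (h1.add h2)
      rwa [add_zero, add_zero] at this
    filter_upwards [herr.eventually_lt_const hLε, hau.eventually_lt_const one_pos,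
      hm.eventually_ge_atTop 8, hm.eventually_ge_atTop (2 * L)] with n h1 h2 h3 h4
    have := norm_sum_exp_hrec_sub_le (hCmem n) (nonempty_of_hasLaw (hτ n) (hC n))
      (Nat.cast_pos.1 hL0) h4 h3 h2.le (r := r n) rfl
    rw [dist_zero_right, norm_norm]
    exact lt_of_le_of_lt this h1
  simpa using hA.mul hphase

/-! ### Asymptotics of the normalising coefficients -/

theorem tendsto_sqrt_log_natCast : Tendsto (fun n : ℕ => √(Real.log n)) atTop atTop :=
  Real.tendsto_sqrt_atTop.comp (Real.tendsto_log_atTop.comp tendsto_natCast_atTop_atTop)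

/-- The hypothesis gives `n ≤ B * m * √(log n)` eventually, so `log n - log m` is at most `log B +
log √(log n)`, negligible against `√(log n)`. -/
theorem tendsto_log_sub_log_div {m : ℕ → ℕ} {β : ℝ} (hmn : ∀ n, m n ≤ n)
    (hm : Tendsto m atTop atTop)
    (hβ : Tendsto (fun n : ℕ => (n : ℝ) / √(Real.log n) / m n) atTop (𝓝 β)) :
    Tendsto (fun n : ℕ => (Real.log (m n) - Real.log n) / √(Real.log n)) atTop (𝓝 0) := by
  have hy := tendsto_sqrt_log_natCast
  obtain ⟨B, hB0, hB⟩ : ∃ B : ℝ, 0 < B ∧ β < B := ⟨|β| + 1, by positivity, by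
    have := le_abs_self β
    linarith⟩
  have hlow : Tendsto (fun n : ℕ => -(Real.log B / √(Real.log n) +
      Real.log √(Real.log n) / √(Real.log n))) atTop (𝓝 0) := by
    have h1 : Tendsto (fun n : ℕ => Real.log √(Real.log n) / √(Real.log n)) atTop (𝓝 0) :=
      Real.isLittleO_log_id_atTop.tendsto_div_nhds_zero.comp hy
    have := ((hy.const_div_atTop (Real.log B)).add h1).neg
    simpa using this
  refine tendsto_of_tendsto_of_tendsto_of_le_of_le' hlow tendsto_const_nhds ?_ ?_
  · filter_upwards [hβ.eventually_lt_const hB, hy.eventually_gt_atTop 0,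
      hm.eventually_gt_atTop 0] with n h1 h2 h3
    have hm0 : (0 : ℝ) < m n := Nat.cast_pos.2 h3
    have hn0 : (0 : ℝ) < n := Nat.cast_pos.2 (h3.trans_le (hmn n))
    have h4 : (n : ℝ) ≤ B * m n * √(Real.log n) := by
      rw [div_lt_iff₀ hm0, div_lt_iff₀ h2] at h1
      exact h1.le
    have h5 := Real.log_le_log hn0 h4
    rw [Real.log_mul (by positivity) h2.ne', Real.log_mul hB0.ne' hm0.ne'] at h5
    rw [← add_div, ← neg_div]
    gcongr
    linarith
  · filter_upwards [hm.eventually_gt_atTop 0] with n h3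
    refine div_nonpos_of_nonpos_of_nonneg ?_ (Real.sqrt_nonneg _)
    exact sub_nonpos.2 (Real.log_le_log (Nat.cast_pos.2 h3) (Nat.cast_le.2 (hmn n)))

theorem tendsto_sqrt_log_div_sqrt_log {m : ℕ → ℕ} {β : ℝ} (hmn : ∀ n, m n ≤ n)
    (hm : Tendsto m atTop atTop)
    (hβ : Tendsto (fun n : ℕ => (n : ℝ) / √(Real.log n) / m n) atTop (𝓝 β)) :
    Tendsto (fun n : ℕ => √(Real.log (m n)) / √(Real.log n)) atTop (𝓝 1) := by
  have hy := tendsto_sqrt_log_natCast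
  have h1 : Tendsto (fun n : ℕ => Real.log (m n) / Real.log n) atTop (𝓝 1) := by
    have := ((tendsto_log_sub_log_div hmn hm hβ).mul (hy.const_div_atTop 1)).add_const 1
    rw [zero_mul, zero_add] at this
    refine this.congr' ?_
    filter_upwards [hy.eventually_gt_atTop 0] with n hn
    have h2 : Real.log n = √(Real.log n) * √(Real.log n) :=
      (Real.mul_self_sqrt (Real.log_natCast_nonneg n)).symm
    have h3 : 0 < Real.log n := by rw [h2]; positivity
    rw [div_mul_div_comm, ← h2]
    field_simp
    ring
  have := (Real.continuous_sqrt.tendsto _).comp h1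
  rw [Real.sqrt_one] at this
  exact this.congr fun n => Real.sqrt_div (Real.log_natCast_nonneg _) _

theorem tendsto_sub_div_div_sqrt_log {m : ℕ → ℕ} {β : ℝ} (hm : Tendsto m atTop atTop)
    (hβ : Tendsto (fun n : ℕ => (n : ℝ) / √(Real.log n) / m n) atTop (𝓝 β)) :
    Tendsto (fun n : ℕ => ((n : ℝ) - m n) / m n / √(Real.log n)) atTop (𝓝 β) := by
  have := hβ.sub (tendsto_sqrt_log_natCast.const_div_atTop 1)
  rw [sub_zero] at this
  refine this.congr' ?_
  filter_upwards [hm.eventually_gt_atTop 0] with n hn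
  have hm0 : (m n : ℝ) ≠ 0 := Nat.cast_ne_zero.2 hn.ne'
  rw [sub_div, div_self hm0]
  ring

/-- Here `β` plays the role of `1 / α`, so `β = 0` covers `α = ∞`. Dividing through by `√(log n)`
sends the two terms of the denominator to `β` and `1`. -/
theorem tendsto_coeffs_of_tendsto {m : ℕ → ℕ} {β : ℝ} (hβ0 : 0 ≤ β) (hmn : ∀ n, m n ≤ n)
    (hm : Tendsto m atTop atTop)
    (hβ : Tendsto (fun n : ℕ => (n : ℝ) / √(Real.log n) / m n) atTop (𝓝 β)) :
    Tendsto (fun n : ℕ => √(Real.log (m n)) / (((n : ℝ) - m n) / m n + √(Real.log (m n)))) atTop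
        (𝓝 (1 / (β + 1))) ∧
      Tendsto (fun n : ℕ => ((n : ℝ) - m n) / m n / (((n : ℝ) - m n) / m n + √(Real.log (m n))))
        atTop (𝓝 (β / (β + 1))) := by
  have hs := tendsto_sqrt_log_div_sqrt_log hmn hm hβ
  have hr := tendsto_sub_div_div_sqrt_log hm hβ
  have hy := tendsto_sqrt_log_natCast.eventually_gt_atTop 0
  constructor
  · refine (hs.div (hr.add hs) (by positivity)).congr' ?_
    filter_upwards [hy] with n hn
    rw [Pi.div_apply, ← add_div, div_div_div_cancel_right₀ hn.ne']
  · refine (hr.div (hr.add hs) (by positivity)).congr' ?_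
    filter_upwards [hy] with n hn
    rw [Pi.div_apply, ← add_div, div_div_div_cancel_right₀ hn.ne']

/-- For `α = 0` the logarithms of `m` and `n` need not be comparable, so one divides by `(n - m) /
m` instead and only uses `log m ≤ log n`. -/
theorem tendsto_coeffs_of_tendsto_zero {m : ℕ → ℕ} (hmn : ∀ n, m n ≤ n)
    (hm : Tendsto m atTop atTop)
    (h0 : Tendsto (fun n : ℕ => (m n : ℝ) / ((n : ℝ) / √(Real.log n))) atTop (𝓝 0)) :
    Tendsto (fun n : ℕ => √(Real.log (m n)) / (((n : ℝ) - m n) / m n + √(Real.log (m n)))) atTop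
        (𝓝 0) ∧
      Tendsto (fun n : ℕ => ((n : ℝ) - m n) / m n / (((n : ℝ) - m n) / m n + √(Real.log (m n))))
        atTop (𝓝 1) := by
  have hy := tendsto_sqrt_log_natCast
  have hq : Tendsto (fun n : ℕ => (m n : ℝ) / n) atTop (𝓝 0) := by
    have := h0.mul (hy.const_div_atTop 1)
    rw [zero_mul] at this
    refine this.congr' ?_
    filter_upwards [hy.eventually_gt_atTop 0] with n hn
    rw [div_div_eq_mul_div]
    field_simp
  have hratio : Tendsto (fun n : ℕ => √(Real.log (m n)) / (((n : ℝ) - m n) / m n)) atTop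
      (𝓝 0) := by
    have hb := h0.div (hq.const_sub 1) (by norm_num)
    rw [zero_div] at hb
    refine squeeze_zero' ?_ ?_ hb
    · exact Eventually.of_forall fun n => div_nonneg (Real.sqrt_nonneg _)
        (div_nonneg (sub_nonneg.2 (Nat.cast_le.2 (hmn n))) (Nat.cast_nonneg _))
    · filter_upwards [hm.eventually_gt_atTop 0, hq.eventually_lt_const one_pos] with n h1 h2
      have hm0 : (0 : ℝ) < m n := Nat.cast_pos.2 h1
      have hn0 : (0 : ℝ) < n := Nat.cast_pos.2 (h1.trans_le (hmn n))
      have h3 : (m n : ℝ) < n := by rwa [div_lt_one hn0] at h2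
      have h4 : (0 : ℝ) < n - m n := sub_pos.2 h3
      have h5 : (m n : ℝ) / ((n : ℝ) / √(Real.log n)) / (1 - m n / n) =
          √(Real.log n) / (((n : ℝ) - m n) / m n) := by
        have : 1 - (m n : ℝ) / n = (n - m n) / n := by rw [sub_div, div_self hn0.ne']
        rw [this, div_div_eq_mul_div]
        field_simp
      rw [Pi.div_apply, h5]
      gcongr
  have hpos : ∀ᶠ n : ℕ in atTop, 0 < ((n : ℝ) - m n) / m n := by
    filter_upwards [hm.eventually_gt_atTop 0, hq.eventually_lt_const one_pos] with n h1 h2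
    have hm0 : (0 : ℝ) < m n := Nat.cast_pos.2 h1
    have hn0 : (0 : ℝ) < n := Nat.cast_pos.2 (h1.trans_le (hmn n))
    have h3 : (m n : ℝ) < n := by rwa [div_lt_one hn0] at h2
    exact div_pos (sub_pos.2 h3) hm0
  have hden := hratio.const_add 1
  constructor
  · have := hratio.div hden (by norm_num)
    rw [zero_div] at this
    refine this.congr' ?_
    filter_upwards [hpos] with n hn
    have hs := Real.sqrt_nonneg (Real.log (m n))
    rw [Pi.div_apply]
    generalize ((n : ℝ) - m n) / m n = ρ at hn ⊢
    generalize √(Real.log (m n)) = s at hs ⊢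
    have h1 : 1 + s / ρ = (ρ + s) / ρ := by rw [add_div, div_self hn.ne']
    rw [h1, div_div_div_cancel_right₀ hn.ne']
  · have := hden.inv₀ (by norm_num)
    rw [add_zero, inv_one] at this
    refine this.congr' ?_
    filter_upwards [hpos] with n hn
    have hs := Real.sqrt_nonneg (Real.log (m n))
    generalize ((n : ℝ) - m n) / m n = ρ at hn ⊢
    generalize √(Real.log (m n)) = s at hs ⊢
    have h1 : 1 + s / ρ = (ρ + s) / ρ := by rw [add_div, div_self hn.ne']
    rw [h1, inv_div]

theorem tendsto_coeffs {m : ℕ → ℕ} {α : ℝ≥0∞} (hmn : ∀ n, m n ≤ n)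
    (hm : Tendsto m atTop atTop)
    (hα : Tendsto (fun n : ℕ => ENNReal.ofReal ((m n : ℝ) / ((n : ℝ) / √(Real.log n)))) atTop
      (𝓝 α)) :
    Tendsto (fun n : ℕ => √(Real.log (m n)) / (((n : ℝ) - m n) / m n + √(Real.log (m n)))) atTop
        (𝓝 (gaussCoeff α)) ∧
      Tendsto (fun n : ℕ => ((n : ℝ) - m n) / m n / (((n : ℝ) - m n) / m n + √(Real.log (m n))))
        atTop (𝓝 (gammaCoeff α)) := by
  have hinv : ∀ n : ℕ, ((m n : ℝ) / ((n : ℝ) / √(Real.log n)))⁻¹ = (n : ℝ) / √(Real.log n) / m n :=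
    fun n => inv_div _ _
  rw [gaussCoeff, gammaCoeff]
  split_ifs with h
  · rw [h, ENNReal.tendsto_ofReal_nhds_top] at hα
    have hβ : Tendsto (fun n : ℕ => (n : ℝ) / √(Real.log n) / m n) atTop (𝓝 0) :=
      hα.inv_tendsto_atTop.congr hinv
    simpa using tendsto_coeffs_of_tendsto le_rfl hmn hm hβ
  · have hreal : Tendsto (fun n : ℕ => (m n : ℝ) / ((n : ℝ) / √(Real.log n))) atTop
        (𝓝 α.toReal) :=
      ((ENNReal.tendsto_toReal h).comp hα).congr fun n => ENNReal.toReal_ofReal (by positivity)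
    rcases ENNReal.toReal_nonneg.eq_or_lt with h0 | h0
    · rw [← h0] at hreal ⊢
      simpa using tendsto_coeffs_of_tendsto_zero hmn hm hreal
    · have hβ : Tendsto (fun n : ℕ => (n : ℝ) / √(Real.log n) / m n) atTop (𝓝 α.toReal⁻¹) :=
        (hreal.inv₀ h0.ne').congr hinv
      have e1 : α.toReal / (α.toReal + 1) = 1 / (α.toReal⁻¹ + 1) := by field_simp; ring
      have e2 : 1 / (α.toReal + 1) = α.toReal⁻¹ / (α.toReal⁻¹ + 1) := by field_simp; ring
      rw [e1, e2]
      exact tendsto_coeffs_of_tendsto (inv_nonneg.2 h0.le) hmn hm hβ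

/-! ### Conclusion -/

theorem numFixed_eq_sub {n : ℕ} (t : n.Partition) :
    (numFixed t : ℝ) = (n : ℝ) - numNonFixed t := by
  rw [numNonFixed, Nat.cast_sub (numFixed_le t)]
  ring

/-- The function `n / √(log n)` is eventually at least `√n`, hence unbounded, and `m` eventually
dominates it. -/
theorem tendsto_of_isLittleO {m : ℕ → ℕ}
    (h : (fun n : ℕ => (n : ℝ) / √(Real.log n)) =o[atTop] fun n : ℕ => (m n : ℝ)) :
    Tendsto m atTop atTop := by
  have h1 : Tendsto (fun n : ℕ => (n : ℝ) / √(Real.log n)) atTop atTop := by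
    refine tendsto_atTop_mono' atTop ?_
      (Real.tendsto_sqrt_atTop.comp tendsto_natCast_atTop_atTop)
    filter_upwards [tendsto_sqrt_log_natCast.eventually_gt_atTop 0] with n hn
    rw [Function.comp_apply, le_div_iff₀ hn]
    calc √(n : ℝ) * √(Real.log n) ≤ √(n : ℝ) * √(n : ℝ) := by
          gcongr
          exact Real.log_le_self (Nat.cast_nonneg n)
      _ = n := Real.mul_self_sqrt (Nat.cast_nonneg n)
  have h2 : Tendsto (fun n : ℕ => (m n : ℝ)) atTop atTop := by
    refine tendsto_atTop_mono' atTop ?_ h1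
    filter_upwards [h.bound one_pos] with n hn
    rw [one_mul, Real.norm_of_nonneg (by positivity), Real.norm_of_nonneg (by positivity)] at hn
    exact hn
  exact tendsto_natCast_atTop_iff.1 h2

theorem mainTheorem4
    (t : (n : ℕ) → n.Partition)
    {Ω : ℕ → Type*} [∀ n, MeasurableSpace (Ω n)]
    (P : (n : ℕ) → Measure (Ω n)) [∀ n, IsProbabilityMeasure (P n)]
    (τ : (n : ℕ) → Ω n → Equiv.Perm (Fin n))
    (hτ : ∀ n, HasLaw (τ n) (uniformOn (cyclicPerms (t n))) (P n))
    {Ω' : Type*} [MeasurableSpace Ω'] (Q : Measure Ω') [IsProbabilityMeasure Q]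
    (Y G : Ω' → ℝ)
    (hY : HasLaw Y (gaussianReal 0 1) Q)
    (hG : HasLaw G (gammaMeasure 2 1) Q)
    (hYG : IndepFun Y G Q) :
    (∀ α : ℝ≥0∞,
      Tendsto (fun n : ℕ => numNonFixed (t n)) atTop atTop →
      Tendsto (fun n : ℕ =>
          ENNReal.ofReal ((numNonFixed (t n) : ℝ) / ((n : ℝ) / √(Real.log (n : ℝ)))))
        atTop (𝓝 α) →
      TendstoInDistribution
        (fun (n : ℕ) (ω : Ω n) =>
          ((hrec (τ n ω) : ℝ) - Real.log (numNonFixed (t n) : ℝ)) /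
            ((numFixed (t n) : ℝ) / (numNonFixed (t n) : ℝ)
              + √(Real.log (numNonFixed (t n) : ℝ))))
        atTop
        (fun ω' => gaussCoeff α * Y ω' + gammaCoeff α * G ω')
        P Q) ∧
    ((fun n : ℕ => (n : ℝ) / √(Real.log (n : ℝ))) =o[atTop]
        (fun n : ℕ => (numNonFixed (t n) : ℝ)) →
      TendstoInDistribution
        (fun (n : ℕ) (ω : Ω n) =>
          ((hrec (τ n ω) : ℝ) - Real.log (n : ℝ)) / √(Real.log (n : ℝ)))
        atTop Y P Q) := by
  constructor
  · intro α hm hα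
    obtain ⟨hc, hd⟩ := tendsto_coeffs (m := fun n => numNonFixed (t n))
      (fun n => Nat.sub_le _ _) hm hα
    simp only [numFixed_eq_sub]
    refine tendstoInDistribution_hrec t P τ hτ Q Y G hY hG hYG _ _ hm
      (Eventually.of_forall fun n => ?_) hc hd (by simp)
    exact le_add_of_nonneg_left (div_nonneg
      (sub_nonneg.2 (Nat.cast_le.2 (Nat.sub_le _ _))) (Nat.cast_nonneg _))
  · intro h
    have hm := tendsto_of_isLittleO h
    have hmn : ∀ n, numNonFixed (t n) ≤ n := fun n => Nat.sub_le _ _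
    have hβ := h.tendsto_div_nhds_zero
    -- The general limit is applied again, now with centring `log n` and scale `√(log n)`; the
    -- limiting coefficients are `1` and `0`.
    have := tendstoInDistribution_hrec t P τ hτ Q Y G hY hG hYG (fun n => √(Real.log n))
      (fun n => Real.log n) hm ?_ (tendsto_sqrt_log_div_sqrt_log hmn hm hβ)
      (tendsto_sub_div_div_sqrt_log hm hβ) (tendsto_log_sub_log_div hmn hm hβ)
    · simpa using this
    · filter_upwards [hm.eventually_gt_atTop 0] with n hn
      exact Real.sqrt_le_sqrt (Real.log_le_log (Nat.cast_pos.2 hn) (Nat.cast_le.2 (hmn n)))
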